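/- **Discrete entropy stability of the curvilinear DGSEM for the resistive GLM-MHD equations.** *Equations.* The state is $u=(\rho,\rho\vec v,E,\vec B,\psi)^T\in\mathbb R^9$. Let $\gamma>1$, $R>0$, $\mu_{NS},\mu_R,\kappa,\alpha\ge 0$, $c_h\in\mathbb R$ be constants, $p=(\gamma-1)\left(E-\frac12\rho|\vec v|^2-\frac12|\vec B|^2-\frac12\psi^2\right)$, $\beta=\frac{\rho}{2p}$, $s=\ln(p\rho^{-\gamma})$, $S(u)=-\frac{\rho s}{\gamma-1}$ and $$w=\tfrac{\partial S}{\partial u}=\left(\tfrac{\gamma-s}{\gamma-1}-\beta|\vec v|^2,\;2\beta\vec v,\;-2\beta,\;2\beta\vec B,\;2\beta\psi\right)^T .$$ For $\ell=1,2,3$ the advective flux $f^a_\ell$ has the components (density, momentum $c$, energy, magnetic field $c$, $\psi$) $$\rho v_\ell,\quad \rho v_\ell v_c-B_\ell B_c+\delta_{\ell c}\left(p+\tfrac12|\vec B|^2\right),\quad v_\ell\left(\tfrac12\rho|\vec v|^2+\tfrac{\gamma p}{\gamma-1}+|\vec B|^2\right)-B_\ell(\vec v\cdot\vec B)+c_h\psi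 B_\ell,\quad v_\ell B_c-B_\ell v_c+\delta_{\ell c}c_h\psi,\quad c_hB_\ell .$$ With $\tau_{\ell c}=\mu_{NS}(\partial_\ell v_c+\partial_c v_\ell)-\frac23\mu_{NS}(\nabla\cdot\vec v)\delta_{\ell c}$ the viscous flux $f^v_\ell$ has the components $$0,\quad \tau_{\ell c},\quad \sum_c\tau_{\ell c}v_c+\tfrac{\kappa}{R}\partial_\ell\tfrac p\rho-\mu_R\left((\nabla\times\vec B)\times\vec B\right)_\ell,\quad \mu_R(\partial_\ell B_c-\partial_cB_\ell),\quad 0 .$$ It is regarded as a function $f^v(u,q)$ of $u$ and of the gradient $q=(q_1,q_2,q_3)$, $q_\ell\in\mathbb R^9$, of the entropy variables, through $$\partial_\ell v_c=-\tfrac{q_{\ell,1+c}}{w_5}+\tfrac{w_{1+c}}{w_5^2}q_{\ell,5},\qquad \partial_\ell B_c=-\tfrac{q_{\ell,5+c}}{w_5}+\tfrac{w_{5+c}}{w_5^2}q_{\ell,5},\qquad \partial_\ell\tfrac p\rho=\tfrac{q_{\ell,5}}{w_5^2}.$$ Further let $\Upsilon=(0,\vec B,\vec v\cdot\vec B,\vec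 v,0)^T$ (Powell vector), $\phi_\ell=(0,\vec 0,v_\ell\psi,\vec 0,v_\ell)^T$ and $r=(0,\vec0,0,\vec0,-\alpha\psi)^T$. A product $\vec g\cdot f$ of a spatial vector and a block vector is $\sum_\ell g_\ell f_\ell$. *Two-point flux.* Write $\langle a\rangle=\frac12(a_L+a_R)$ and $a^{\ln}=\frac{a_R-a_L}{\ln a_R-\ln a_L}$ ($=a_L$ if $a_L=a_R$). The entropy conservative flux $f^{ec}_\ell(u_L,u_R)$ has the components $$f_\rho=\rho^{\ln}\langle v_\ell\rangle,\quad f_{m_c}=f_\rho\langle v_c\rangle-\langle B_\ell\rangle\langle B_c\rangle+\delta_{\ell c}\left(\tfrac{\langle\rho\rangle}{2\langle\beta\rangle}+\tfrac12\sum_i\langle B_i^2\rangle\right),\quad f_{B_c}=\langle v_\ell\rangle\langle B_c\rangle-\langle v_c\rangle\langle B_\ell\rangle+\delta_{\ell c}c_h\langle\psi\rangle,\quad f_\psi=c_h\langle B_\ell\rangle,$$ $$f_E=f_\rho\left[\tfrac1{2(\gamma-1)\beta^{\ln}}-\tfrac12\sum_i\langle v_i^2\rangle\right]+\sum_i\left(f_{m_i}\langle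 v_i\rangle+f_{B_i}\langle B_i\rangle\right)+f_\psi\langle\psi\rangle-\tfrac12\sum_i\langle v_\ell B_i^2\rangle+\sum_i\langle v_iB_i\rangle\langle B_\ell\rangle-c_h\langle B_\ell\psi\rangle .$$ *Discretization.* Let $N\ge1$, let $\xi_0<\dots<\xi_N$ be the Legendre-Gauss-Lobatto nodes on $[-1,1]$ (the zeros of $(1-x^2)P_N'(x)$), $\ell_j$ their Lagrange polynomials, $\omega_j=\int_{-1}^1\ell_j$, $D_{ij}=\ell_j'(\xi_i)$. Nodal fields on $[-1,1]^3$ are identified with their interpolants of degree $N$ in each variable, $\langle f,g\rangle_N=\sum_{i,j,k}\omega_i\omega_j\omega_k f_{ijk}\cdot g_{ijk}$, and $\int_{\partial E,N}$ is the same quadrature on the six faces. *Mesh.* There are finitely many elements. The mapping $\vec X$ of each element is represented by its degree-$N$ interpolant, i.e. by its nodal values; all derivatives below are derivatives of interpolants, evaluated at the nodes. Put $\vec a_i=\partial\vec X/\partial\xi^i$, $J=\vec a_1\cdot(\vec a_2\times\vec a_3)$, assumed positive at all nodes, and, with $I^N$ the interpolation, $Ja^i_n=-\left(\nabla_\xi\times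 I^N(X_l\nabla_\xi X_m)\right)_i$ for $(n,m,l)$ cyclic. On a face $\xi^i=\pm1$ let $\hat s=|J\vec a^{\,i}|$ and let $\vec n=\pm J\vec a^{\,i}/\hat s$ be the outward normal. The mesh is conforming and fully periodic: every element face is identified with exactly one other element face by a symmetry of the square, the positions of corresponding face nodes agree up to a translation that depends only on the face, and the two elements lie on opposite sides of the interface (the identification reverses the orientations induced by the outward directions). At a face node, "pri" denotes the value from the element and "sec" the value at the corresponding node of the neighbouring face; at interfaces $\langle a\rangle=\frac12(a^{pri}+a^{sec})$. *Scheme.* At a node $x$ let $x_{d,m}$ denote the node whose $d$-th index is replaced by $m$, let $x_d$ be the $d$-th index of $x$, and write $\langle J\vec a^{\,d}\rangle$ for the mean of the values at $x$ and $x_{d,m}$. Put $$\mathbb D F^a=\sum_{d,m}2D_{x_dm}\langle J\vec a^{\,d}\rangle\cdot f^{ec}(U_x,U_{x_{d,m}}),\qquad \mathbb D^{MHD}=\sum_{d,m}D_{x_dm}\left(\vec B_{x_{d,m}}\cdot\langle J\vec a^{\,d}\rangle\right)\Upsilon_x,$$ $$\mathbb D^{GLM}=\sum_{d,m}D_{x_dm}\,\psi_{x_{d,m}}\,(J\vec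 a^{\,d}_x\cdot\phi_x),\qquad \mathbb D^SG=\sum_{d,m}D_{x_dm}\,(J\vec a^{\,d}\cdot G)_{x_{d,m}}\ \text{ for block vectors } G .$$ A solution on a time interval $I$ is a time-differentiable nodal field $U(t)$ such that, for each $t\in I$, there is a nodal block vector $Q$ with the following property, where $W=w(U)$ and $F^v=f^v(U,Q)$: on every element and for all polynomial test functions $\varphi$ (states) and $\vartheta$ (block vectors), $$\begin{aligned}&\langle JU_t,\varphi\rangle_N+\langle\mathbb DF^a+\mathbb D^{MHD}+\mathbb D^{GLM},\varphi\rangle_N+\int_{\partial E,N}\varphi^T\left\{F_n^{a,*}-F^a_n+B^*-\Upsilon(\vec B\cdot\vec n)+\Psi^*-(\phi\cdot\vec n)\psi\right\}\hat s\,dS\\&\qquad=\langle\mathbb D^SF^v,\varphi\rangle_N+\int_{\partial E,N}\varphi^T\left\{F_n^{v,*}-F_n^v\right\}\hat s\,dS+\langle Jr(U),\varphi\rangle_N,\\&\langle JQ,\vartheta\rangle_N=\int_{\partial E,N}(W^*)^T(\vartheta\cdot\vec n)\,\hat s\,dS-\langle W,\mathbb D^S\vartheta\rangle_N,\end{aligned}$$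 where $F^a_n=f^a(U^{pri})\cdot\vec n$, $F^v_n=(F^v)^{pri}\cdot\vec n$, and $$F^{a,*}_n=f^{ec}(U^{pri},U^{sec})\cdot\vec n,\quad B^*=\Upsilon^{pri}\langle\vec B\rangle\cdot\vec n,\quad \Psi^*=(\phi^{pri}\cdot\vec n)\langle\psi\rangle,\quad F_n^{v,*}=\langle F^v\rangle\cdot\vec n,\quad W^*=\langle W\rangle .$$ *Theorem.* Let $U$ be a solution of this scheme on a time interval $I$, on a fully periodic conforming mesh, with $\rho>0$ and $p>0$ at all nodes and all times of $I$. Then the discrete total entropy $\bar S(t)=\sum_{\text{elements}}\langle J\,S(U(t)),1\rangle_N$ is differentiable on $I$, satisfies $$\frac{d\bar S}{dt}\le0\quad\text{on } I,$$ and is therefore a non-increasing function of time. -/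

import Mathlib

noncomputable section

namespace GLMMHD

/-! ## Legendre-Gauss-Lobatto nodes and the one-dimensional operators -/

/-- The Legendre polynomial of degree `N`, by Rodrigues' formula. -/
def legendre (N : ℕ) : Polynomial ℝ :=
  Polynomial.C (1 / (2 ^ N * (N.factorial : ℝ))) *
    (Polynomial.derivative^[N]) ((Polynomial.X ^ 2 - 1) ^ N)

/-- `ξ` lists, in increasing order, the `N + 1` Legendre-Gauss-Lobatto nodes: the zeros of
`(1 - x ^ 2) * P_N'(x)`, a polynomial of degree `N + 1` when `1 ≤ N`. -/
def IsLGL (N : ℕ) (ξ : Fin (N + 1) → ℝ) : Prop :=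
  StrictMono ξ ∧
    ∀ i, ((1 - Polynomial.X ^ 2) * Polynomial.derivative (legendre N)).eval (ξ i) = 0

/-- The nodal Lagrange basis polynomial of index `j`. -/
def lagrangeBasis {N : ℕ} (ξ : Fin (N + 1) → ℝ) (j : Fin (N + 1)) : Polynomial ℝ :=
  Lagrange.basis Finset.univ ξ j

/-- The quadrature weight of index `j`, the integral of the Lagrange basis polynomial. -/
def weight {N : ℕ} (ξ : Fin (N + 1) → ℝ) (j : Fin (N + 1)) : ℝ :=
  ∫ x in (-1 : ℝ)..1, (lagrangeBasis ξ j).eval x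

/-- The derivative matrix: the derivative of the basis polynomial `j` at the node `i`. -/
def derMatrix {N : ℕ} (ξ : Fin (N + 1) → ℝ) (i j : Fin (N + 1)) : ℝ :=
  (Polynomial.derivative (lagrangeBasis ξ j)).eval (ξ i)

/-! ## States and block vectors -/

/-- Spatial vectors. -/
abbrev Vec3 := Fin 3 → ℝ

/-- States `(ρ, ρ v, E, B, ψ)`, and all other vectors with nine components. -/
abbrev State := Fin 9 → ℝ

/-- Block vectors: one nine-component vector for each spatial direction. -/
abbrev Block := Fin 3 → State

/-- Assemble a nine-component vector from its scalar and vectorial parts. -/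
def mkState (a : ℝ) (m : Vec3) (e : ℝ) (b : Vec3) (s : ℝ) : State :=
  ![a, m 0, m 1, m 2, e, b 0, b 1, b 2, s]

/-- Kronecker symbol. -/
def kron (k l : Fin 3) : ℝ := if k = l then 1 else 0

/-- `g · f`, the state `∑ ℓ, g ℓ • f ℓ`, for a spatial vector `g` and a block vector `f`. -/
def dotBlock (g : Vec3) (f : Block) : State := ∑ l, g l • f l

/-! ## The resistive GLM-MHD equations -/

/-- Constants of the model: adiabatic coefficient, viscosity, resistivity, thermal conductivity,
gas constant, GLM wave speed and GLM damping parameter. -/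
structure Params where
  γ : ℝ
  μNS : ℝ
  μR : ℝ
  κ : ℝ
  R : ℝ
  ch : ℝ
  α : ℝ

/-- Density. -/
def dens (u : State) : ℝ := u 0
/-- Total energy. -/
def energy (u : State) : ℝ := u 4
/-- Velocity, momentum divided by density. -/
def vel (u : State) : Vec3 := ![u 1 / u 0, u 2 / u 0, u 3 / u 0]
/-- Magnetic field. -/
def mag (u : State) : Vec3 := ![u 5, u 6, u 7]
/-- The divergence cleaning variable. -/
def psi (u : State) : ℝ := u 8

/-- Pressure, from the ideal gas law. -/
def pressure (P : Params) (u : State) : ℝ :=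
  (P.γ - 1) * (energy u - 1 / 2 * dens u * (vel u ⬝ᵥ vel u) - 1 / 2 * (mag u ⬝ᵥ mag u)
    - 1 / 2 * psi u ^ 2)

/-- `β = ρ / (2 p)`. -/
def beta (P : Params) (u : State) : ℝ := dens u / (2 * pressure P u)

/-- Thermodynamic entropy `s = ln (p ρ ^ (-γ))`. -/
def thermoEntropy (P : Params) (u : State) : ℝ :=
  Real.log (pressure P u * dens u ^ (-P.γ))

/-- The mathematical entropy density `S = - ρ s / (γ - 1)`. -/
def entropy (P : Params) (u : State) : ℝ := -(dens u * thermoEntropy P u) / (P.γ - 1)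

/-- The entropy variables `w = ∂S/∂u`. -/
def entropyVars (P : Params) (u : State) : State :=
  mkState ((P.γ - thermoEntropy P u) / (P.γ - 1) - beta P u * (vel u ⬝ᵥ vel u))
    ((2 * beta P u) • vel u) (-(2 * beta P u)) ((2 * beta P u) • mag u) (2 * beta P u * psi u)

/-- Euler part of the advective flux in direction `l`. -/
def fluxEuler (P : Params) (u : State) (l : Fin 3) : State :=
  mkState (dens u * vel u l)
    (fun c => dens u * vel u l * vel u c + pressure P u * kron l c)
    (vel u l * (1 / 2 * dens u * (vel u ⬝ᵥ vel u) + P.γ * pressure P u / (P.γ - 1)))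
    0 0

/-- Ideal MHD part of the advective flux in direction `l`. -/
def fluxMHD (u : State) (l : Fin 3) : State :=
  mkState 0
    (fun c => 1 / 2 * (mag u ⬝ᵥ mag u) * kron l c - mag u l * mag u c)
    (vel u l * (mag u ⬝ᵥ mag u) - mag u l * (vel u ⬝ᵥ mag u))
    (fun c => vel u l * mag u c - mag u l * vel u c)
    0

/-- GLM part of the advective flux in direction `l`. -/
def fluxGLM (P : Params) (u : State) (l : Fin 3) : State :=
  mkState 0 0 (P.ch * psi u * mag u l) (fun c => P.ch * psi u * kron l c) (P.ch * mag u l)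

/-- The advective flux. -/
def advFlux (P : Params) (u : State) : Block :=
  fun l => fluxEuler P u l + fluxMHD u l + fluxGLM P u l

/-- The state vector of the Powell term. -/
def powell (u : State) : State := mkState 0 (mag u) (vel u ⬝ᵥ mag u) (vel u) 0

/-- The block vector of the non-conservative GLM term. -/
def phiGLM (u : State) : Block := fun l => mkState 0 0 (vel u l * psi u) 0 (vel u l)

/-- The damping source term. -/
def source (P : Params) (u : State) : State := mkState 0 0 0 0 (-(P.α * psi u))

/-- The curl, from the matrix `G` of the partial derivatives `G l k = ∂ B_l / ∂ x_k`. -/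
def curlOf (G : Fin 3 → Vec3) : Vec3 := fun i => G (i + 2) (i + 1) - G (i + 1) (i + 2)

/-- The viscous stress tensor, from `Gv l k = ∂ v_l / ∂ x_k`. -/
def stress (P : Params) (Gv : Fin 3 → Vec3) (k l : Fin 3) : ℝ :=
  P.μNS * (Gv l k + Gv k l) - 2 / 3 * P.μNS * (∑ i, Gv i i) * kron k l

/-- The viscous and resistive flux in terms of the state and of the physical gradients
`Gv l k = ∂ v_l / ∂ x_k`, `GB l k = ∂ B_l / ∂ x_k`, `GT k = ∂ (p / ρ) / ∂ x_k`.
The energy component is `τ v + (κ / R) ∇(p / ρ) - μR (∇ × B) × B`. -/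
def viscFluxPhys (P : Params) (u : State) (Gv GB : Fin 3 → Vec3) (GT : Vec3) : Block :=
  fun k => mkState 0 (fun l => stress P Gv k l)
    ((∑ l, stress P Gv k l * vel u l) + P.κ / P.R * GT k
      - P.μR * crossProduct (curlOf GB) (mag u) k)
    (fun c => P.μR * (GB c k - GB k c)) 0

/-- The gradient of the velocity recovered from a gradient `q` of the entropy variables,
`∇ v_l = - (1 / w₅) ∇ w_{1+l} + (w_{1+l} / w₅ ^ 2) ∇ w₅`. -/
def gradVel (P : Params) (u : State) (q : Block) (l k : Fin 3) : ℝ :=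
  let w := entropyVars P u
  (![w 1, w 2, w 3] l) / w 4 ^ 2 * q k 4 - 1 / w 4 * (![q k 1, q k 2, q k 3] l)

/-- The gradient of the magnetic field recovered from a gradient of the entropy variables. -/
def gradMag (P : Params) (u : State) (q : Block) (l k : Fin 3) : ℝ :=
  let w := entropyVars P u
  (![w 5, w 6, w 7] l) / w 4 ^ 2 * q k 4 - 1 / w 4 * (![q k 5, q k 6, q k 7] l)

/-- The gradient of `p / ρ` recovered from a gradient of the entropy variables. -/
def gradTemp (P : Params) (u : State) (q : Block) (k : Fin 3) : ℝ :=
  1 / entropyVars P u 4 ^ 2 * q k 4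

/-- The viscous and resistive flux as a function of the state and of the gradient `q` of the
entropy variables. It is linear in `q`. -/
def viscFlux (P : Params) (u : State) (q : Block) : Block :=
  viscFluxPhys P u (gradVel P u q) (gradMag P u q) (gradTemp P u q)

/-! ## The entropy conservative two-point flux -/

/-- Arithmetic mean. -/
def avg (a b : ℝ) : ℝ := 1 / 2 * (a + b)

/-- Logarithmic mean, continued by its limit at `a = b`. -/
def logMean (a b : ℝ) : ℝ := if a = b then a else (b - a) / (Real.log b - Real.log a)

/-- The arithmetic mean of a quantity `f` between two states. -/
def avgOf (f : State → ℝ) (uL uR : State) : ℝ := avg (f uL) (f uR)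

/-- Density component of the entropy conservative flux. -/
def ecDens (uL uR : State) (l : Fin 3) : ℝ :=
  logMean (dens uL) (dens uR) * avgOf (fun u => vel u l) uL uR

/-- Momentum components of the entropy conservative flux. -/
def ecMom (P : Params) (uL uR : State) (l c : Fin 3) : ℝ :=
  ecDens uL uR l * avgOf (fun u => vel u c) uL uR
    - avgOf (fun u => mag u l) uL uR * avgOf (fun u => mag u c) uL uR
    + kron l c * (avgOf dens uL uR / (2 * avgOf (beta P) uL uR)
        + 1 / 2 * ∑ i, avgOf (fun u => mag u i * mag u i) uL uR)

/-- Magnetic field components of the entropy conservative flux. -/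
def ecMag (P : Params) (uL uR : State) (l c : Fin 3) : ℝ :=
  avgOf (fun u => vel u l) uL uR * avgOf (fun u => mag u c) uL uR
    - avgOf (fun u => vel u c) uL uR * avgOf (fun u => mag u l) uL uR
    + kron l c * (P.ch * avgOf psi uL uR)

/-- Component of the entropy conservative flux for the divergence cleaning variable. -/
def ecPsi (P : Params) (uL uR : State) (l : Fin 3) : ℝ :=
  P.ch * avgOf (fun u => mag u l) uL uR

/-- Energy component of the entropy conservative flux. -/
def ecEnergy (P : Params) (uL uR : State) (l : Fin 3) : ℝ :=
  ecDens uL uR l * (1 / (2 * (P.γ - 1) * logMean (beta P uL) (beta P uR))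
      - 1 / 2 * ∑ i, avgOf (fun u => vel u i ^ 2) uL uR)
    + ∑ i, ecMom P uL uR l i * avgOf (fun u => vel u i) uL uR
    + ∑ i, ecMag P uL uR l i * avgOf (fun u => mag u i) uL uR
    + ecPsi P uL uR l * avgOf psi uL uR
    - 1 / 2 * ∑ i, avgOf (fun u => vel u l * mag u i ^ 2) uL uR
    + ∑ i, avgOf (fun u => vel u i * mag u i) uL uR * avgOf (fun u => mag u l) uL uR
    - P.ch * avgOf (fun u => mag u l * psi u) uL uR

/-- The entropy conservative two-point flux, in the three spatial directions. -/
def ecFlux (P : Params) (uL uR : State) : Block :=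
  fun l => mkState (ecDens uL uR l) (ecMom P uL uR l) (ecEnergy P uL uR l)
    (ecMag P uL uR l) (ecPsi P uL uR l)

/-! ## Nodes, faces and discrete integrals on the reference element `[-1, 1] ^ 3` -/

/-- Indices of the tensor product nodes. -/
abbrev Node (N : ℕ) := Fin 3 → Fin (N + 1)

/-- Faces of the reference cube: `(d, true)` is `ξ^d = 1` and `(d, false)` is `ξ^d = -1`. -/
abbrev Face := Fin 3 × Bool

/-- `1` or `-1`, the side of the reference cube on which the face lies. -/
def Face.side (f : Face) : ℝ := if f.2 then 1 else -1

/-- The node of the face `f = (d, _)` with index `a` in direction `d + 1` and index `b` in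
direction `d + 2` (cyclically). -/
def faceNode {N : ℕ} (f : Face) (ab : Fin (N + 1) × Fin (N + 1)) : Node N := fun e =>
  if e = f.1 then (if f.2 then Fin.last N else 0) else if e = f.1 + 1 then ab.1 else ab.2

/-- The volume quadrature, `∑ ω_i ω_j ω_k h_{ijk}`. -/
def volQuad {N : ℕ} (ξ : Fin (N + 1) → ℝ) (h : Node N → ℝ) : ℝ :=
  ∑ p : Node N, (∏ d, weight ξ (p d)) * h p

/-- The surface quadrature over the six faces. -/
def surfQuad {N : ℕ} (ξ : Fin (N + 1) → ℝ)
    (h : Face → Fin (N + 1) × Fin (N + 1) → ℝ) : ℝ :=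
  ∑ f : Face, ∑ ab : Fin (N + 1) × Fin (N + 1), weight ξ ab.1 * weight ξ ab.2 * h f ab

/-- The derivative in the reference direction `d` of the interpolant of a nodal function. -/
def nodalDeriv {N : ℕ} (ξ : Fin (N + 1) → ℝ) (d : Fin 3) (g : Node N → ℝ) (p : Node N) : ℝ :=
  ∑ m, derMatrix ξ (p d) m * g (Function.update p d m)

/-! ## Curvilinear elements -/

/-- Covariant basis vector `∂X/∂ξ^d` at the nodes. -/
def covariant {N : ℕ} (ξ : Fin (N + 1) → ℝ) (X : Node N → Vec3) (p : Node N) (d : Fin 3) : Vec3 :=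
  fun n => nodalDeriv ξ d (fun q => X q n) p

/-- Jacobian `a₁ · (a₂ × a₃)` at the nodes. -/
def jacobian {N : ℕ} (ξ : Fin (N + 1) → ℝ) (X : Node N → Vec3) (p : Node N) : ℝ :=
  covariant ξ X p 0 ⬝ᵥ crossProduct (covariant ξ X p 1) (covariant ξ X p 2)

/-- Volume weighted contravariant vectors in curl form: component `n` of `J a^i` is
`- (∇_ξ × I(X_l ∇_ξ X_m))_i` with `(n, m, l)` cyclic and `I` the interpolation at the nodes. -/
def metric {N : ℕ} (ξ : Fin (N + 1) → ℝ) (X : Node N → Vec3) (p : Node N) (i : Fin 3) : Vec3 :=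
  fun n =>
    -(nodalDeriv ξ (i + 1) (fun q => X q (n + 2) * covariant ξ X q (i + 2) (n + 1)) p
      - nodalDeriv ξ (i + 2) (fun q => X q (n + 2) * covariant ξ X q (i + 1) (n + 1)) p)

/-- The surface element `|J a^d|` at a face node. -/
def surfElem {N : ℕ} (ξ : Fin (N + 1) → ℝ) (X : Node N → Vec3) (f : Face)
    (ab : Fin (N + 1) × Fin (N + 1)) : ℝ :=
  Real.sqrt (metric ξ X (faceNode f ab) f.1 ⬝ᵥ metric ξ X (faceNode f ab) f.1)

/-- The outward unit normal `± J a^d / |J a^d|` at a face node. -/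
def normal {N : ℕ} (ξ : Fin (N + 1) → ℝ) (X : Node N → Vec3) (f : Face)
    (ab : Fin (N + 1) × Fin (N + 1)) : Vec3 :=
  (f.side / surfElem ξ X f ab) • metric ξ X (faceNode f ab) f.1

/-! ## Periodic conforming meshes -/

/-- A symmetry of the square: exchange of the two coordinates (if `swap`), then reversal of the
first coordinate (if `flip₁`) and of the second one (if `flip₂`). -/
structure FaceOrientation where
  swap : Bool
  flip₁ : Bool
  flip₂ : Bool

/-- Action of a symmetry of the square on the indices of the nodes of a face. -/
def FaceOrientation.act {N : ℕ} (o : FaceOrientation) (ab : Fin (N + 1) × Fin (N + 1)) :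
    Fin (N + 1) × Fin (N + 1) :=
  let cd := if o.swap then (ab.2, ab.1) else ab
  (if o.flip₁ then Fin.rev cd.1 else cd.1, if o.flip₂ then Fin.rev cd.2 else cd.2)

/-- The determinant of a symmetry of the square. -/
def FaceOrientation.det (o : FaceOrientation) : ℝ :=
  (if o.swap then -1 else 1) * (if o.flip₁ then -1 else 1) * (if o.flip₂ then -1 else 1)

/-- A fully periodic conforming mesh of curvilinear hexahedra. The element mappings are the
polynomials of degree at most `N` in each variable with the nodal values `X`. Every face of every
element is glued to exactly one other face; corresponding nodes have the same position up to a
translation (zero for interior interfaces, a period of the domain for periodic ones). -/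
structure PeriodicMesh (N : ℕ) (ξ : Fin (N + 1) → ℝ) (Elem : Type*) where
  /-- Positions of the nodes of each element. -/
  X : Elem → Node N → Vec3
  /-- The Jacobian is positive. -/
  jac_pos : ∀ ν p, 0 < jacobian ξ (X ν) p
  /-- The face on the other side of the interface. -/
  nbr : Elem × Face → Elem × Face
  nbr_ne : ∀ F, nbr F ≠ F
  nbr_nbr : ∀ F, nbr (nbr F) = F
  /-- How the nodes of a face correspond to those of its neighbour. -/
  orient : Elem × Face → FaceOrientation
  orient_nbr : ∀ F (ab : Fin (N + 1) × Fin (N + 1)),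
    (orient (nbr F)).act ((orient F).act ab) = ab
  /-- The two elements lie on opposite sides of the interface: the identification reverses the
  orientations that the outward directions induce on the two faces. -/
  orient_det : ∀ F, (orient F).det = -(Face.side F.2 * Face.side (nbr F).2)
  /-- The translation across the interface. -/
  shift : Elem × Face → Vec3
  conforming : ∀ F (ab : Fin (N + 1) × Fin (N + 1)),
    X (nbr F).1 (faceNode (nbr F).2 ((orient F).act ab)) = X F.1 (faceNode F.2 ab) + shift F

namespace PeriodicMesh

variable {N : ℕ} {ξ : Fin (N + 1) → ℝ} {Elem : Type*}

/-- Jacobian of the element `ν`. -/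
def J (M : PeriodicMesh N ξ Elem) (ν : Elem) (p : Node N) : ℝ := jacobian ξ (M.X ν) p

/-- Volume weighted contravariant vectors of the element `ν`. -/
def Ja (M : PeriodicMesh N ξ Elem) (ν : Elem) (p : Node N) (i : Fin 3) : Vec3 :=
  metric ξ (M.X ν) p i

/-- The arithmetic mean of `J a^d` between the nodes `p` and `q`. -/
def avgJa (M : PeriodicMesh N ξ Elem) (ν : Elem) (p q : Node N) (d : Fin 3) : Vec3 :=
  fun n => avg (M.Ja ν p d n) (M.Ja ν q d n)

/-- The contravariant components of a block vector field. -/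
def contra (M : PeriodicMesh N ξ Elem) (ν : Elem) (F : Node N → Block) : Node N → Block :=
  fun p d => dotBlock (M.Ja ν p d) (F p)

/-- The value of a nodal field at a face node, from inside the element (primary side). -/
def prim {V : Type*} (_M : PeriodicMesh N ξ Elem) (Y : Elem → Node N → V) (ν : Elem)
    (f : Face) (ab : Fin (N + 1) × Fin (N + 1)) : V :=
  Y ν (faceNode f ab)

/-- The value of a nodal field at a face node, from the neighbour (secondary side). -/
def sec {V : Type*} (M : PeriodicMesh N ξ Elem) (Y : Elem → Node N → V) (ν : Elem)
    (f : Face) (ab : Fin (N + 1) × Fin (N + 1)) : V :=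
  Y (M.nbr (ν, f)).1 (faceNode (M.nbr (ν, f)).2 ((M.orient (ν, f)).act ab))

/-! ### Volume operators -/

/-- Split form divergence of the advective flux, with the entropy conservative volume flux. -/
def splitDiv (M : PeriodicMesh N ξ Elem) (P : Params) (ν : Elem) (U : Node N → State)
    (p : Node N) : State :=
  ∑ d, ∑ m, (2 * derMatrix ξ (p d) m) •
    dotBlock (M.avgJa ν p (Function.update p d m) d) (ecFlux P (U p) (U (Function.update p d m)))

/-- Volume discretization of the Powell term. -/
def powellVol (M : PeriodicMesh N ξ Elem) (ν : Elem) (U : Node N → State) (p : Node N) : State :=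
  ∑ d, ∑ m, (derMatrix ξ (p d) m *
    (mag (U (Function.update p d m)) ⬝ᵥ M.avgJa ν p (Function.update p d m) d)) • powell (U p)

/-- Volume discretization of the non-conservative GLM term. -/
def glmVol (M : PeriodicMesh N ξ Elem) (ν : Elem) (U : Node N → State) (p : Node N) : State :=
  ∑ d, ∑ m, (derMatrix ξ (p d) m * psi (U (Function.update p d m))) •
    dotBlock (M.Ja ν p d) (phiGLM (U p))

/-- Standard collocation divergence of the contravariant components of a block vector field. -/
def stdDiv (M : PeriodicMesh N ξ Elem) (ν : Elem) (F : Node N → Block) (p : Node N) : State :=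
  ∑ d, ∑ m, derMatrix ξ (p d) m • M.contra ν F (Function.update p d m) d

/-! ### Interface terms, at a node of a face with outward normal `n` -/

/-- `F_n^{a,*} - F_n^a`, with the entropy conservative surface flux. -/
def advJump (P : Params) (n : Vec3) (uPri uSec : State) : State :=
  dotBlock n (ecFlux P uPri uSec) - dotBlock n (advFlux P uPri)

/-- `B* - (Powell vector) B_n`, with `B* = (Powell vector)^pri ⟨B⟩ · n`. -/
def powellJump (n : Vec3) (uPri uSec : State) : State :=
  ((fun c => avg (mag uPri c) (mag uSec c)) ⬝ᵥ n) • powell uPri - (mag uPri ⬝ᵥ n) • powell uPri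

/-- `Ψ* - (φ · n) ψ`, with `Ψ* = (φ^pri · n) ⟨ψ⟩`. -/
def glmJump (n : Vec3) (uPri uSec : State) : State :=
  avg (psi uPri) (psi uSec) • dotBlock n (phiGLM uPri) - psi uPri • dotBlock n (phiGLM uPri)

/-- `F_n^{v,*} - F_n^v`, with the BR1 flux `F_n^{v,*} = ⟨F^v⟩ · n`. -/
def viscJump (n : Vec3) (FPri FSec : Block) : State :=
  dotBlock n (fun l c => avg (FPri l c) (FSec l c)) - dotBlock n FPri

/-- The BR1 interface value `W* = ⟨W⟩`. -/
def br1W (wPri wSec : State) : State := fun c => avg (wPri c) (wSec c)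

/-! ### The scheme -/

/-- Nodal viscous fluxes. -/
def viscField (_M : PeriodicMesh N ξ Elem) (P : Params) (U : Elem → Node N → State)
    (Q : Elem → Node N → Block) : Elem → Node N → Block :=
  fun ν p => viscFlux P (U ν p) (Q ν p)

/-- The first equation of the scheme on the element `ν`, for the nodal values `U` of the solution,
`Ut` of its time derivative, `Q` of the auxiliary gradient, and for the test function `φ`. -/
def SolutionEq (M : PeriodicMesh N ξ Elem) (P : Params) (U Ut : Elem → Node N → State)
    (Q : Elem → Node N → Block) (ν : Elem) (φ : Node N → State) : Prop :=
  volQuad ξ (fun p => M.J ν p * (Ut ν p ⬝ᵥ φ p))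
    + volQuad ξ (fun p => M.splitDiv P ν (U ν) p ⬝ᵥ φ p)
    + surfQuad ξ (fun f ab => (φ (faceNode f ab) ⬝ᵥ
        advJump P (normal ξ (M.X ν) f ab) (M.prim U ν f ab) (M.sec U ν f ab))
          * surfElem ξ (M.X ν) f ab)
    + volQuad ξ (fun p => M.powellVol ν (U ν) p ⬝ᵥ φ p)
    + surfQuad ξ (fun f ab => (φ (faceNode f ab) ⬝ᵥ
        powellJump (normal ξ (M.X ν) f ab) (M.prim U ν f ab) (M.sec U ν f ab))
          * surfElem ξ (M.X ν) f ab)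
    + volQuad ξ (fun p => M.glmVol ν (U ν) p ⬝ᵥ φ p)
    + surfQuad ξ (fun f ab => (φ (faceNode f ab) ⬝ᵥ
        glmJump (normal ξ (M.X ν) f ab) (M.prim U ν f ab) (M.sec U ν f ab))
          * surfElem ξ (M.X ν) f ab)
  = volQuad ξ (fun p => M.stdDiv ν (M.viscField P U Q ν) p ⬝ᵥ φ p)
    + surfQuad ξ (fun f ab => (φ (faceNode f ab) ⬝ᵥ
        viscJump (normal ξ (M.X ν) f ab) (M.prim (M.viscField P U Q) ν f ab)
          (M.sec (M.viscField P U Q) ν f ab))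
          * surfElem ξ (M.X ν) f ab)
    + volQuad ξ (fun p => M.J ν p * (source P (U ν p) ⬝ᵥ φ p))

/-- The second equation of the scheme on the element `ν`, which determines the auxiliary gradient
`Q` of the entropy variables, for the test function `ϑ`. -/
def GradientEq (M : PeriodicMesh N ξ Elem) (P : Params) (U : Elem → Node N → State)
    (Q : Elem → Node N → Block) (ν : Elem) (ϑ : Node N → Block) : Prop :=
  volQuad ξ (fun p => M.J ν p * ∑ k, Q ν p k ⬝ᵥ ϑ p k)
  = surfQuad ξ (fun f ab =>
        (br1W (entropyVars P (M.prim U ν f ab)) (entropyVars P (M.sec U ν f ab)) ⬝ᵥ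
          dotBlock (normal ξ (M.X ν) f ab) (ϑ (faceNode f ab)))
          * surfElem ξ (M.X ν) f ab)
    - volQuad ξ (fun p => entropyVars P (U ν p) ⬝ᵥ M.stdDiv ν ϑ p)

/-- `U` solves the semi-discrete scheme on the time interval `I`: its nodal values are
differentiable in time and satisfy both equations, on all elements and for all polynomial test
functions, at all times of `I`. -/
def IsSolution (M : PeriodicMesh N ξ Elem) (P : Params) (I : Set ℝ)
    (U : ℝ → Elem → Node N → State) : Prop :=
  ∃ (Ut : ℝ → Elem → Node N → State) (Q : ℝ → Elem → Node N → Block), ∀ t ∈ I, ∀ ν,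
    (∀ p c, HasDerivWithinAt (fun s => U s ν p c) (Ut t ν p c) I t) ∧
    (∀ φ : Node N → State, M.SolutionEq P (U t) (Ut t) (Q t) ν φ) ∧
    (∀ ϑ : Node N → Block, M.GradientEq P (U t) (Q t) ν ϑ)

/-- The discrete total entropy. -/
def totalEntropy [Fintype Elem] (M : PeriodicMesh N ξ Elem) (P : Params)
    (U : Elem → Node N → State) : ℝ :=
  ∑ ν, volQuad ξ (fun p => M.J ν p * entropy P (U ν p))

end PeriodicMesh

end GLMMHD

end

/-!
The scheme is tested with the entropy variables `W` of the discrete solution. Since `W` is the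
gradient of the entropy density, the time derivative then becomes the rate of change of the total
entropy (`hasDerivWithinAt_entropy`), and every other term is shown to vanish after summation over
the mesh or to have a sign.

*Advective terms.* The two-point flux satisfies the discrete entropy condition
`ecFlux_entropy_condition`, in which the non-conservative remainder is exactly the one produced by
the Powell term; the GLM term is orthogonal to `W`. The derivative matrix has the summation by
parts property (`IsLGL.summation_by_parts`), because Legendre-Gauss-Lobatto quadrature is exact up
to degree `2 * N - 1`, which rests on the orthogonality of the Legendre polynomials. As the metric
terms are a discrete curl, their discrete divergence vanishes (`sum_nodalDeriv_metric`). With these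
facts the flux differencing volume sum telescopes (`volQuad_fluxDiff`), and the advective terms
reduce to face terms (`PeriodicMesh.adv_balance`).

*Viscous terms.* The gradient equation tested with the viscous flux turns the divergence into the
contraction of the viscous flux with the gradient `Q` of the entropy variables, up to face terms
(`PeriodicMesh.visc_balance`). This contraction is a sum of squares (`sum_dot_viscFlux_nonneg`),
and it is integrated with nonnegative quadrature weights and a positive Jacobian.

*Interfaces.* The metric terms on a face depend only on the positions of the nodes of that face and
change by the determinant under a symmetry of the square (`faceMetric_comp_act`). The area vectors
on the two sides of an interface are therefore opposite (`PeriodicMesh.areaVec_nbr`), and the face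
terms of the two sides cancel: for the advective flux by the discrete entropy condition, for the
viscous flux by the symmetry of the arithmetic means. What remains is the viscous dissipation and
the damping source, which do not increase the entropy.
-/

noncomputable section

namespace GLMMHD

/-! ### Legendre-Gauss-Lobatto quadrature -/

section Quadrature

open Polynomial

/-- The definite integral of a real polynomial over `[-1, 1]`. -/
def polyInt (p : ℝ[X]) : ℝ := ∫ x in (-1 : ℝ)..1, p.eval x

theorem polyInt_add (p q : ℝ[X]) : polyInt (p + q) = polyInt p + polyInt q := by
  simp only [polyInt, eval_add]
  exact intervalIntegral.integral_add (p.continuous.intervalIntegrable _ _)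
    (q.continuous.intervalIntegrable _ _)

theorem polyInt_C_mul (c : ℝ) (p : ℝ[X]) : polyInt (C c * p) = c * polyInt p := by
  simp [polyInt, eval_mul]

theorem polyInt_sum {ι : Type*} (s : Finset ι) (f : ι → ℝ[X]) :
    polyInt (∑ i ∈ s, f i) = ∑ i ∈ s, polyInt (f i) := by
  classical
  induction s using Finset.induction_on with
  | empty => simp [polyInt]
  | insert a s ha ih => rw [Finset.sum_insert ha, Finset.sum_insert ha, polyInt_add, ih]

theorem polyInt_derivative (p : ℝ[X]) : polyInt (derivative p) = p.eval 1 - p.eval (-1) :=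
  intervalIntegral.integral_eq_sub_of_hasDerivAt (fun x _ => p.hasDerivAt x)
    ((derivative p).continuous.intervalIntegrable _ _)

theorem polyInt_derivative_mul (p q : ℝ[X]) : polyInt (derivative p * q)
    = (p * q).eval 1 - (p * q).eval (-1) - polyInt (p * derivative q) := by
  rw [← polyInt_derivative, derivative_mul, polyInt_add]
  ring

theorem polyInt_comp_neg_X (p : ℝ[X]) : polyInt (p.comp (-X)) = polyInt p := by
  have h := intervalIntegral.integral_comp_neg (a := -1) (b := 1) (fun x : ℝ => p.eval x)
  simpa [polyInt, eval_comp] using h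

theorem polyInt_nonneg {p : ℝ[X]} (h : ∀ x, -1 ≤ x → x ≤ 1 → 0 ≤ p.eval x) : 0 ≤ polyInt p :=
  intervalIntegral.integral_nonneg (by norm_num) fun x hx => h x hx.1 hx.2

theorem polyInt_pos {p : ℝ[X]} (hp : p ≠ 0) (h : ∀ x, -1 ≤ x → x ≤ 1 → 0 ≤ p.eval x) :
    0 < polyInt p := by
  obtain ⟨c, hc, hcr⟩ := (Set.Ioo_infinite (show (-1 : ℝ) < 1 by norm_num)).exists_notMem_finset
    p.roots.toFinset
  refine intervalIntegral.integral_pos (by norm_num) p.continuous.continuousOn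
    (fun x hx => h x hx.1.le hx.2) ⟨c, ⟨hc.1.le, hc.2.le⟩, ?_⟩
  refine lt_of_le_of_ne (h c hc.1.le hc.2.le) fun h0 => hcr ?_
  rw [Multiset.mem_toFinset, mem_roots hp]
  exact h0.symm

/-- Repeated integration by parts; all boundary terms vanish because `±1` are zeros of order `N`
of `(X ^ 2 - 1) ^ N`. -/
theorem polyInt_iterate_derivative_mul (N k : ℕ) (hk : k ≤ N) (q : ℝ[X]) :
    polyInt (derivative^[k] ((X ^ 2 - 1 : ℝ[X]) ^ N) * q)
      = (-1) ^ k * polyInt ((X ^ 2 - 1) ^ N * derivative^[k] q) := by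
  induction k generalizing q with
  | zero => simp
  | succ k ih =>
    have hdvd : (X ^ 2 - 1 : ℝ[X]) ∣ derivative^[k] ((X ^ 2 - 1 : ℝ[X]) ^ N) :=
      (dvd_pow_self _ (by omega)).trans (pow_sub_dvd_iterate_derivative_pow _ N k)
    obtain ⟨r, hr⟩ := hdvd
    have h : ∀ x : ℝ, x ^ 2 = 1 →
        (derivative^[k] ((X ^ 2 - 1 : ℝ[X]) ^ N) * q).eval x = 0 := fun x hx => by
      rw [hr]; simp [hx]
    rw [Function.iterate_succ_apply', polyInt_derivative_mul, h 1 (by norm_num),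
      h (-1) (by norm_num), ih (by omega), Function.iterate_succ_apply]
    ring

theorem polyInt_legendre_mul {N : ℕ} {q : ℝ[X]} (hq : q.natDegree < N) :
    polyInt (legendre N * q) = 0 := by
  rw [legendre, mul_assoc, polyInt_C_mul, polyInt_iterate_derivative_mul N N le_rfl,
    iterate_derivative_eq_zero hq]
  simp [polyInt]

/-- The polynomial `(1 - X ^ 2) * P_N'`, whose zeros are the Legendre-Gauss-Lobatto nodes. -/
def lobatto (N : ℕ) : ℝ[X] := (1 - X ^ 2) * derivative (legendre N)

theorem polyInt_lobatto_mul {N : ℕ} {q : ℝ[X]} (hq : q.natDegree + 1 < N) :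
    polyInt (lobatto N * q) = 0 := by
  have h : lobatto N * q = derivative (legendre N) * ((1 - X ^ 2) * q) := by
    rw [lobatto]; ring
  have hdeg : (derivative ((1 - X ^ 2 : ℝ[X]) * q)).natDegree < N := by
    have h1 := natDegree_derivative_le ((1 - X ^ 2 : ℝ[X]) * q)
    have h2 : ((1 - X ^ 2 : ℝ[X]) * q).natDegree ≤ (1 - X ^ 2 : ℝ[X]).natDegree + q.natDegree :=
      natDegree_mul_le
    have h3 : (1 - X ^ 2 : ℝ[X]).natDegree ≤ 2 := by compute_degree
    omega
  rw [h, polyInt_derivative_mul, polyInt_legendre_mul hdeg]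
  simp

theorem natDegree_sq_sub_one_pow (N : ℕ) : ((X ^ 2 - 1 : ℝ[X]) ^ N).natDegree = 2 * N := by
  have h : (X ^ 2 - 1 : ℝ[X]).natDegree = 2 := by compute_degree!
  rw [natDegree_pow, h, mul_comm]

theorem natDegree_lobatto_le (N : ℕ) (hN : 1 ≤ N) : (lobatto N).natDegree ≤ N + 1 := by
  have h1 : (lobatto N).natDegree ≤ _ := natDegree_mul_le
  have h2 : (1 - X ^ 2 : ℝ[X]).natDegree ≤ 2 := by compute_degree
  have h3 := natDegree_derivative_le (legendre N)
  have h4 : (legendre N).natDegree ≤ N := by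
    refine (natDegree_C_mul_le _ _).trans ((natDegree_iterate_derivative _ _).trans ?_)
    rw [natDegree_sq_sub_one_pow]
    omega
  omega

theorem lobatto_ne_zero (N : ℕ) (hN : 1 ≤ N) : lobatto N ≠ 0 := by
  refine mul_ne_zero ?_ ?_
  · intro h
    have := congrArg (eval 0) h
    simp at this
  · rw [legendre, derivative_C_mul, ← Function.iterate_succ_apply' (f := derivative)]
    refine mul_ne_zero ?_ ?_
    · rw [Ne, C_eq_zero]; positivity
    · intro h
      have h1 := congrArg (fun p : ℝ[X] => p.coeff (N - 1)) h
      simp only [coeff_iterate_derivative, coeff_zero] at h1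
      have h2 : N - 1 + (N + 1) = 2 * N := by omega
      have hm : ((X ^ 2 - 1 : ℝ[X]) ^ N).Monic := by
        refine Monic.pow ?_ N
        monicity!
      have h3 : ((X ^ 2 - 1 : ℝ[X]) ^ N).coeff (2 * N) = 1 := by
        rw [← natDegree_sq_sub_one_pow N]
        exact hm.coeff_natDegree
      rw [h2, h3, nsmul_eq_mul, mul_one, Nat.cast_eq_zero, Nat.descFactorial_eq_zero_iff_lt] at h1
      omega

theorem iterate_derivative_comp_neg_X (p : ℝ[X]) (k : ℕ) :
    derivative^[k] (p.comp (-X)) = (-1) ^ k * (derivative^[k] p).comp (-X) := by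
  induction k with
  | zero => simp
  | succ k ih =>
    have h : derivative ((-1 : ℝ[X]) ^ k) = 0 := by
      rw [← C_1, ← C_neg, ← C_pow, derivative_C]
    rw [Function.iterate_succ_apply', ih, derivative_mul, derivative_comp, h,
      Function.iterate_succ_apply']
    simp only [derivative_neg, derivative_X]
    ring

theorem eval_lobatto_neg (N : ℕ) (x : ℝ) (hx : (lobatto N).eval x = 0) :
    (lobatto N).eval (-x) = 0 := by
  set g : ℝ[X] := derivative^[N + 1] ((X ^ 2 - 1 : ℝ[X]) ^ N) with hg
  have hL : lobatto N = (1 - X ^ 2) * (C (1 / (2 ^ N * (N.factorial : ℝ))) * g) := by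
    rw [lobatto, legendre, derivative_C_mul, ← Function.iterate_succ_apply' (f := derivative)]
  have h := iterate_derivative_comp_neg_X ((X ^ 2 - 1 : ℝ[X]) ^ N) (N + 1)
  have hc : ((X ^ 2 - 1 : ℝ[X]) ^ N).comp (-X) = (X ^ 2 - 1) ^ N := by simp
  rw [hc, ← hg] at h
  have h2 : g.eval x = (-1) ^ (N + 1) * g.eval (-x) := by
    conv_lhs => rw [h]
    simp [eval_comp]
  rw [hL] at hx ⊢
  simp only [eval_mul, eval_sub, eval_one, eval_pow, eval_X, eval_C] at hx ⊢
  rw [h2] at hx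
  have h3 : ((-1 : ℝ) ^ (N + 1)) * ((-1 : ℝ) ^ (N + 1)) = 1 := by
    rw [← mul_pow]; norm_num
  linear_combination (-1) ^ (N + 1) * hx
    - (1 - x ^ 2) * (1 / (2 ^ N * (N.factorial : ℝ)) * g.eval (-x)) * h3

variable {N : ℕ} {ξ : Fin (N + 1) → ℝ}

namespace IsLGL

theorem injOn (hξ : IsLGL N ξ) : Set.InjOn ξ ((Finset.univ : Finset (Fin (N + 1))) : Set _) :=
  hξ.1.injective.injOn

/-- `(1 - X ^ 2) * P_N'` has degree `N + 1`, so the nodes are all its zeros, each simple. -/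
theorem lobatto_eq (hN : 1 ≤ N) (hξ : IsLGL N ξ) :
    ∃ c : ℝ, c ≠ 0 ∧ lobatto N = C c * Lagrange.nodal Finset.univ ξ := by
  have hdvd : Lagrange.nodal Finset.univ ξ ∣ lobatto N := by
    rw [Lagrange.nodal_eq]
    refine Finset.prod_dvd_of_coprime (fun i _ j _ hij => ?_) fun i _ => ?_
    · exact pairwise_coprime_X_sub_C hξ.1.injective hij
    · exact dvd_iff_isRoot.mpr (hξ.2 i)
  obtain ⟨r, hr⟩ := hdvd
  have hne := lobatto_ne_zero N hN
  have hr0 : r ≠ 0 := by rintro rfl; simp_all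
  have hd := natDegree_lobatto_le N hN
  rw [hr, natDegree_mul Lagrange.nodal_ne_zero hr0, Lagrange.natDegree_nodal, Finset.card_univ,
    Fintype.card_fin] at hd
  obtain ⟨c, rfl⟩ := natDegree_eq_zero.mp (show r.natDegree = 0 by omega)
  exact ⟨c, by simpa using hr0, by rw [hr, mul_comm]⟩

theorem polyInt_nodal_mul (hN : 1 ≤ N) (hξ : IsLGL N ξ) {q : ℝ[X]} (hq : q.natDegree + 1 < N) :
    polyInt (Lagrange.nodal Finset.univ ξ * q) = 0 := by
  obtain ⟨c, hc, h⟩ := hξ.lobatto_eq hN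
  have h1 := polyInt_lobatto_mul hq
  rw [h, mul_assoc, polyInt_C_mul] at h1
  exact (mul_eq_zero.mp h1).resolve_left hc

theorem exists_of_root (hN : 1 ≤ N) (hξ : IsLGL N ξ) {x : ℝ} (hx : (lobatto N).eval x = 0) :
    ∃ i, ξ i = x := by
  obtain ⟨c, hc, h⟩ := hξ.lobatto_eq hN
  rw [h, eval_mul, eval_C, Lagrange.eval_nodal] at hx
  obtain ⟨i, -, hi⟩ := Finset.prod_eq_zero_iff.mp ((mul_eq_zero.mp hx).resolve_left hc)
  exact ⟨i, by linarith⟩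

theorem quadrature_of_lt (hξ : IsLGL N ξ) {p : ℝ[X]} (hp : p.natDegree < N + 1) :
    polyInt p = ∑ i, weight ξ i * p.eval (ξ i) := by
  have h := Lagrange.eq_interpolate (f := p) (s := Finset.univ) hξ.injOn
    (by simpa using degree_le_natDegree.trans_lt (Nat.cast_lt.mpr hp))
  conv_lhs => rw [h, Lagrange.interpolate_apply]
  rw [polyInt_sum]
  refine Finset.sum_congr rfl fun i _ => ?_
  rw [polyInt_C_mul, mul_comm]
  rfl

/-- The Legendre-Gauss-Lobatto quadrature is exact up to degree `2 * N - 1`: after division by the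
nodal polynomial, the quotient is orthogonal to it. -/
theorem quadrature (hN : 1 ≤ N) (hξ : IsLGL N ξ) {p : ℝ[X]} (hp : p.natDegree < 2 * N) :
    polyInt p = ∑ i, weight ξ i * p.eval (ξ i) := by
  set n := Lagrange.nodal Finset.univ ξ with hn
  have hm : n.Monic := Lagrange.nodal_monic
  have hdn : n.natDegree = N + 1 := by simp [hn, Lagrange.natDegree_nodal]
  have hdecomp := modByMonic_add_div p n
  have hlt : (p %ₘ n).natDegree < N + 1 := by
    rw [← hdn]
    refine natDegree_modByMonic_lt _ hm ?_
    intro h; rw [h] at hdn; simp at hdn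
  have hint : polyInt (n * (p /ₘ n)) = 0 := by
    by_cases h0 : p.natDegree < N + 1
    · rw [(divByMonic_eq_zero_iff hm).mpr]
      · simp [polyInt]
      · exact degree_lt_degree (by omega)
    · refine hξ.polyInt_nodal_mul hN ?_
      rw [natDegree_divByMonic p hm, hdn]
      omega
  conv_lhs => rw [← hdecomp]
  rw [polyInt_add, hint, add_zero, hξ.quadrature_of_lt hlt]
  refine Finset.sum_congr rfl fun i _ => ?_
  conv_rhs => rw [← hdecomp]
  rw [eval_add, eval_mul, hn, Lagrange.eval_nodal_at_node (Finset.mem_univ i)]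
  simp

/-- No node lies outside `[-1, 1]`. Otherwise let `r` be the product of the factors of the nodal
polynomial that belong neither to `±1` nor to this node: the nodal polynomial is orthogonal to `r`
by degree, although its product with `r` has a constant sign on `[-1, 1]`. -/
theorem sq_le_one (hN : 1 ≤ N) (hξ : IsLGL N ξ) (k : Fin (N + 1)) : ξ k ^ 2 ≤ 1 := by
  classical
  by_contra! hk
  obtain ⟨a, ha⟩ := hξ.exists_of_root hN (x := 1) (by simp [lobatto])
  obtain ⟨b, hb⟩ := hξ.exists_of_root hN (x := -1) (by simp [lobatto])
  have hab : a ≠ b := by rintro rfl; rw [ha] at hb; norm_num at hb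
  have hka : k ≠ a := by rintro rfl; rw [ha] at hk; norm_num at hk
  have hkb : k ≠ b := by rintro rfl; rw [hb] at hk; norm_num at hk
  set s : Finset (Fin (N + 1)) := ((Finset.univ.erase a).erase b).erase k with hs
  set r := Lagrange.nodal s ξ with hr
  have hbm : b ∈ Finset.univ.erase a := by simp [hab.symm]
  have hkm : k ∈ (Finset.univ.erase a).erase b := by simp [hka, hkb]
  have hnod : Lagrange.nodal Finset.univ ξ = (X - C 1) * ((X - C (-1)) * ((X - C (ξ k)) * r)) := by
    rw [Lagrange.nodal_eq_mul_nodal_erase (Finset.mem_univ a),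
      Lagrange.nodal_eq_mul_nodal_erase hbm, Lagrange.nodal_eq_mul_nodal_erase hkm, ha, hb]
  have hcard : s.card + 3 = N + 1 := by
    have h1 : s.card + 1 = _ := Finset.card_erase_add_one hkm
    have h2 := Finset.card_erase_add_one hbm
    have h3 := Finset.card_erase_add_one (Finset.mem_univ a)
    rw [Finset.card_univ, Fintype.card_fin] at h3
    omega
  have hrdeg : r.natDegree + 1 < N := by
    rw [hr, Lagrange.natDegree_nodal]; omega
  have h0 := hξ.polyInt_nodal_mul hN hrdeg
  rw [hnod] at h0
  -- The factor `ξ k` makes the sign independent of the side: `0 ≤ ξ k * (ξ k - x)` on `[-1, 1]`.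
  have hpos : 0 < polyInt (C (ξ k) * ((X - C 1) * ((X - C (-1)) * ((X - C (ξ k)) * r)) * r)) := by
    refine polyInt_pos ?_ fun x hx1 hx2 => ?_
    · have hk0 : ξ k ≠ 0 := by intro h; rw [h] at hk; norm_num at hk
      exact mul_ne_zero (by simpa using hk0) (mul_ne_zero (mul_ne_zero (X_sub_C_ne_zero _)
        (mul_ne_zero (X_sub_C_ne_zero _) (mul_ne_zero (X_sub_C_ne_zero _)
        Lagrange.nodal_ne_zero))) Lagrange.nodal_ne_zero)
    · simp only [eval_mul, eval_C, eval_sub, eval_X]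
      have h1 : 0 ≤ ξ k * (ξ k - x) := by nlinarith [sq_nonneg (ξ k - x)]
      have h2 : 0 ≤ (1 - x) * (x - -1) := mul_nonneg (by linarith) (by linarith)
      have h3 := mul_nonneg (mul_nonneg h1 h2) (sq_nonneg (r.eval x))
      linarith
  rw [polyInt_C_mul, h0, mul_zero] at hpos
  exact lt_irrefl _ hpos

theorem last_eq (hN : 1 ≤ N) (hξ : IsLGL N ξ) : ξ (Fin.last N) = 1 := by
  obtain ⟨a, ha⟩ := hξ.exists_of_root hN (x := 1) (by simp [lobatto])
  have h1 := hξ.1.monotone (Fin.le_last a)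
  have h2 := hξ.sq_le_one hN (Fin.last N)
  nlinarith

theorem zero_eq (hN : 1 ≤ N) (hξ : IsLGL N ξ) : ξ 0 = -1 := by
  obtain ⟨a, ha⟩ := hξ.exists_of_root hN (x := -1) (by simp [lobatto])
  have h1 := hξ.1.monotone (Fin.zero_le a)
  have h2 := hξ.sq_le_one hN 0
  nlinarith

/-- The weight at `ξ j` is the integral of `r * b ^ 2`, up to a positive factor, where `b` is a
Lagrange polynomial of some of the nodes and `r` vanishes at the other nodes. -/
theorem weight_nonneg_of (hN : 1 ≤ N) (hξ : IsLGL N ξ) (j : Fin (N + 1))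
    (s : Finset (Fin (N + 1))) (hj : j ∈ s) (r : ℝ[X]) (hrs : ∀ k ∉ s, r.eval (ξ k) = 0)
    (hrj : 0 < r.eval (ξ j)) (hr : ∀ x, -1 ≤ x → x ≤ 1 → 0 ≤ r.eval x)
    (hdeg : r.natDegree + 2 * (s.card - 1) < 2 * N) : 0 ≤ weight ξ j := by
  set b := Lagrange.basis s ξ j with hb
  have hinj : Set.InjOn ξ (s : Set _) := hξ.1.injective.injOn
  have hd : (r * b ^ 2).natDegree < 2 * N := by
    refine lt_of_le_of_lt (natDegree_mul_le.trans (Nat.add_le_add_left natDegree_pow_le _)) ?_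
    rw [hb, Lagrange.natDegree_basis hinj hj]
    exact hdeg
  have hq := hξ.quadrature hN hd
  have hnn : 0 ≤ polyInt (r * b ^ 2) := polyInt_nonneg fun x h1 h2 => by
    rw [eval_mul, eval_pow]
    exact mul_nonneg (hr x h1 h2) (sq_nonneg _)
  rw [hq, Finset.sum_eq_single j] at hnn
  · rw [eval_mul, eval_pow, hb, Lagrange.eval_basis_self hinj hj] at hnn
    refine nonneg_of_mul_nonneg_left hnn ?_
    simpa using hrj
  · intro k _ hkj
    by_cases hks : k ∈ s
    · rw [eval_mul, eval_pow, hb, Lagrange.eval_basis_of_ne hkj.symm hks]; simp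
    · rw [eval_mul, hrs k hks]; simp
  · simp

theorem weight_nonneg (hN : 1 ≤ N) (hξ : IsLGL N ξ) (j : Fin (N + 1)) : 0 ≤ weight ξ j := by
  have h1 := hξ.last_eq hN
  have h0 := hξ.zero_eq hN
  have hne : (0 : Fin (N + 1)) ≠ Fin.last N := by
    intro h; rw [h, h1] at h0; norm_num at h0
  have hcu : (Finset.univ : Finset (Fin (N + 1))).card = N + 1 := by simp
  have hd1 : (1 - X : ℝ[X]).natDegree ≤ 1 := by compute_degree
  have hd2 : (1 + X : ℝ[X]).natDegree ≤ 1 := by compute_degree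
  have hd3 : (1 - X ^ 2 : ℝ[X]).natDegree ≤ 2 := by compute_degree
  by_cases hj0 : j = 0
  · subst hj0
    refine hξ.weight_nonneg_of hN 0 (Finset.univ.erase (Fin.last N)) (by simpa using hne) (1 - X)
      ?_ ?_ (fun x _ h => by simpa using h) ?_
    · intro k hk; simp at hk; simp [hk, h1]
    · simp [h0]
    · have := Finset.card_erase_add_one (Finset.mem_univ (Fin.last N)); omega
  by_cases hjl : j = Fin.last N
  · subst hjl
    refine hξ.weight_nonneg_of hN _ (Finset.univ.erase 0) (by simpa using hne.symm) (1 + X)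
      ?_ ?_ (fun x h _ => by simp; linarith) ?_
    · intro k hk; simp at hk; simp [hk, h0]
    · simp [h1]
    · have := Finset.card_erase_add_one (Finset.mem_univ (0 : Fin (N + 1))); omega
  have hlm : Fin.last N ∈ Finset.univ.erase (0 : Fin (N + 1)) := by simpa using hne.symm
  refine hξ.weight_nonneg_of hN j ((Finset.univ.erase 0).erase (Fin.last N)) (by simp [hj0, hjl])
      (1 - X ^ 2) ?_ ?_
      (fun x h h' => by simp only [eval_sub, eval_one, eval_pow, eval_X]; nlinarith) ?_
  · intro k hk
    have : k = Fin.last N ∨ k = 0 := by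
      by_contra! h; exact hk (by simp [h.1, h.2])
    rcases this with rfl | rfl <;> simp [h1, h0]
  · have h2 := hξ.1 (Fin.pos_iff_ne_zero.mpr hj0)
    have h3 := hξ.1 (Fin.lt_last_iff_ne_last.mpr hjl)
    rw [h0] at h2
    rw [h1] at h3
    simp only [eval_sub, eval_one, eval_pow, eval_X]
    nlinarith
  · have h2 := Finset.card_erase_add_one hlm
    have h3 := Finset.card_erase_add_one (Finset.mem_univ (0 : Fin (N + 1)))
    -- An interior node exists only if `2 ≤ N`.
    have h4 : 0 < (((Finset.univ : Finset (Fin (N + 1))).erase 0).erase (Fin.last N)).card :=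
      Finset.card_pos.mpr ⟨j, by simp [hj0, hjl]⟩
    omega

theorem eval_lagrangeBasis (hξ : IsLGL N ξ) (i j : Fin (N + 1)) :
    (lagrangeBasis ξ i).eval (ξ j) = if i = j then 1 else 0 := by
  split_ifs with h
  · subst h; exact Lagrange.eval_basis_self hξ.injOn (Finset.mem_univ _)
  · exact Lagrange.eval_basis_of_ne h (Finset.mem_univ _)

theorem natDegree_lagrangeBasis (hξ : IsLGL N ξ) (i : Fin (N + 1)) :
    (lagrangeBasis ξ i).natDegree = N := by
  rw [lagrangeBasis, Lagrange.natDegree_basis hξ.injOn (Finset.mem_univ _)]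
  simp

theorem sum_derMatrix (hξ : IsLGL N ξ) (i : Fin (N + 1)) : ∑ m, derMatrix ξ i m = 0 := by
  have h := Lagrange.sum_basis (v := ξ) hξ.injOn Finset.univ_nonempty
  have h2 := congrArg (fun p => (derivative p).eval (ξ i)) h
  simpa [derivative_sum, eval_finsetSum, derMatrix, lagrangeBasis] using h2

/-- Summation by parts, from the exactness of the quadrature on `(ℓ_i * ℓ_j)'`. -/
theorem summation_by_parts (hN : 1 ≤ N) (hξ : IsLGL N ξ) (i j : Fin (N + 1)) :
    weight ξ i * derMatrix ξ i j + weight ξ j * derMatrix ξ j i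
      = (if i = Fin.last N ∧ j = Fin.last N then 1 else 0) - (if i = 0 ∧ j = 0 then 1 else 0) := by
  have key : ∀ i j, weight ξ i * derMatrix ξ i j
      = polyInt (lagrangeBasis ξ i * derivative (lagrangeBasis ξ j)) := fun i j => by
    rw [hξ.quadrature hN, Finset.sum_eq_single i]
    · rw [eval_mul, hξ.eval_lagrangeBasis]
      simp [derMatrix]
    · intro k _ hk
      rw [eval_mul, hξ.eval_lagrangeBasis]
      simp [Ne.symm hk]
    · simp
    · have h1 := natDegree_derivative_le (lagrangeBasis ξ j)
      have h2 : (lagrangeBasis ξ i * derivative (lagrangeBasis ξ j)).natDegree ≤ _ :=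
        natDegree_mul_le
      rw [hξ.natDegree_lagrangeBasis] at h1 h2
      omega
  rw [key, key, mul_comm (lagrangeBasis ξ j), polyInt_derivative_mul]
  have h1 := fun k => hξ.eval_lagrangeBasis k (Fin.last N)
  have h0 := fun k => hξ.eval_lagrangeBasis k 0
  rw [hξ.last_eq hN] at h1
  rw [hξ.zero_eq hN] at h0
  simp only [eval_mul, h0, h1]
  simp only [ite_and, ite_mul, one_mul, zero_mul]
  ring

theorem rev_eq (hN : 1 ≤ N) (hξ : IsLGL N ξ) (i : Fin (N + 1)) : ξ (Fin.rev i) = -ξ i := by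
  have hξ' : StrictMono fun i => -ξ (Fin.rev i) := fun a b hab =>
    neg_lt_neg (hξ.1 (Fin.rev_lt_rev.mpr hab))
  have hr : Set.range (fun i => -ξ (Fin.rev i)) = Set.range ξ := by
    ext x
    simp only [Set.mem_range]
    constructor
    · rintro ⟨i, rfl⟩
      exact hξ.exists_of_root hN (eval_lobatto_neg N _ (hξ.2 _))
    · rintro ⟨i, rfl⟩
      obtain ⟨k, hk⟩ := hξ.exists_of_root hN (eval_lobatto_neg N _ (hξ.2 i))
      exact ⟨Fin.rev k, by simp [hk]⟩
  have h := congrFun ((hξ'.range_inj hξ.1).mp hr) i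
  linarith

theorem lagrangeBasis_rev (hN : 1 ≤ N) (hξ : IsLGL N ξ) (j : Fin (N + 1)) :
    lagrangeBasis ξ (Fin.rev j) = (lagrangeBasis ξ j).comp (-X) := by
  have hd : ∀ p : ℝ[X], p.natDegree = N → p.degree < (Finset.univ : Finset (Fin (N + 1))).card :=
    fun p hp => by
      rw [Finset.card_univ, Fintype.card_fin]
      exact degree_le_natDegree.trans_lt (Nat.cast_lt.mpr (by omega))
  refine Polynomial.eq_of_degrees_lt_of_eval_index_eq Finset.univ hξ.injOn
    (hd _ (hξ.natDegree_lagrangeBasis _)) (hd _ ?_) fun i _ => ?_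
  · rw [natDegree_comp, hξ.natDegree_lagrangeBasis, natDegree_neg, natDegree_X, mul_one]
  · rw [eval_comp, eval_neg, eval_X, ← hξ.rev_eq hN, hξ.eval_lagrangeBasis, hξ.eval_lagrangeBasis]
    simp only [Fin.rev_eq_iff]

theorem weight_rev (hN : 1 ≤ N) (hξ : IsLGL N ξ) (j : Fin (N + 1)) :
    weight ξ (Fin.rev j) = weight ξ j := by
  have h := polyInt_comp_neg_X (lagrangeBasis ξ j)
  rw [← hξ.lagrangeBasis_rev hN] at h
  exact h

theorem derMatrix_rev (hN : 1 ≤ N) (hξ : IsLGL N ξ) (i j : Fin (N + 1)) :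
    derMatrix ξ (Fin.rev i) (Fin.rev j) = -derMatrix ξ i j := by
  rw [derMatrix, hξ.lagrangeBasis_rev hN, derivative_comp, hξ.rev_eq hN, derMatrix]
  simp [eval_comp]

end IsLGL

end Quadrature

variable {N : ℕ} {ξ : Fin (N + 1) → ℝ}

/-! ### Summation by parts on the reference element -/

/-- The node with index `i` in direction `d`, on the grid line in direction `d` with transversal
indices `ab` (in the directions `d + 1` and `d + 2`). -/
def lineNode (d : Fin 3) (ab : Fin (N + 1) × Fin (N + 1)) (i : Fin (N + 1)) : Node N := fun e =>
  if e = d then i else if e = d + 1 then ab.1 else ab.2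

theorem faceNode_eq_lineNode (f : Face) (ab : Fin (N + 1) × Fin (N + 1)) :
    faceNode f ab = lineNode f.1 ab (if f.2 then Fin.last N else 0) := rfl

@[simp] theorem lineNode_self (d : Fin 3) (ab : Fin (N + 1) × Fin (N + 1)) (i : Fin (N + 1)) :
    lineNode d ab i d = i := if_pos rfl

theorem update_lineNode (d : Fin 3) (ab : Fin (N + 1) × Fin (N + 1)) (i m : Fin (N + 1)) :
    Function.update (lineNode d ab i) d m = lineNode d ab m := by
  funext e
  by_cases h : e = d
  · subst h; simp
  · simp [lineNode, h]

/-- A node is the same as a grid line in direction `d` together with a position on it. -/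
def lineEquiv (N : ℕ) (d : Fin 3) : (Fin (N + 1) × Fin (N + 1)) × Fin (N + 1) ≃ Node N where
  toFun x := lineNode d x.1 x.2
  invFun p := ((p (d + 1), p (d + 2)), p d)
  left_inv x := by fin_cases d <;> rfl
  right_inv p := by
    funext e
    fin_cases d <;> fin_cases e <;> rfl

theorem volQuad_eq_sum_lines (ξ : Fin (N + 1) → ℝ) (d : Fin 3) (h : Node N → ℝ) :
    volQuad ξ h = ∑ ab : Fin (N + 1) × Fin (N + 1), weight ξ ab.1 * weight ξ ab.2 *
      ∑ i, weight ξ i * h (lineNode d ab i) := by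
  rw [volQuad, ← (lineEquiv N d).sum_comp, Fintype.sum_prod_type]
  refine Finset.sum_congr rfl fun ab _ => ?_
  rw [Finset.mul_sum]
  refine Finset.sum_congr rfl fun i _ => ?_
  have hw : ∏ e, weight ξ (lineNode d ab i e) = weight ξ ab.1 * weight ξ ab.2 * weight ξ i := by
    rw [Fin.prod_univ_three]
    fin_cases d <;> simp [lineNode] <;> ring
  simp only [lineEquiv, Equiv.coe_fn_mk, hw]
  ring

theorem volQuad_add (g h : Node N → ℝ) :
    volQuad ξ (fun p => g p + h p) = volQuad ξ g + volQuad ξ h := by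
  simp only [volQuad, mul_add, Finset.sum_add_distrib]

theorem volQuad_sub (g h : Node N → ℝ) :
    volQuad ξ (fun p => g p - h p) = volQuad ξ g - volQuad ξ h := by
  simp only [volQuad, mul_sub, Finset.sum_sub_distrib]

theorem volQuad_const_mul (c : ℝ) (h : Node N → ℝ) :
    volQuad ξ (fun p => c * h p) = c * volQuad ξ h := by
  simp only [volQuad, Finset.mul_sum]
  exact Finset.sum_congr rfl fun p _ => by ring

theorem volQuad_sum {ι : Type*} (s : Finset ι) (h : ι → Node N → ℝ) :
    volQuad ξ (fun p => ∑ i ∈ s, h i p) = ∑ i ∈ s, volQuad ξ (h i) := by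
  simp only [volQuad, Finset.mul_sum]
  exact Finset.sum_comm

theorem volQuad_nonneg (hN : 1 ≤ N) (hξ : IsLGL N ξ) {h : Node N → ℝ} (hh : ∀ p, 0 ≤ h p) :
    0 ≤ volQuad ξ h :=
  Finset.sum_nonneg fun p _ =>
    mul_nonneg (Finset.prod_nonneg fun _ _ => hξ.weight_nonneg hN _) (hh p)

theorem surfQuad_add (g h : Face → Fin (N + 1) × Fin (N + 1) → ℝ) :
    surfQuad ξ (fun f ab => g f ab + h f ab) = surfQuad ξ g + surfQuad ξ h := by
  simp only [surfQuad, mul_add, Finset.sum_add_distrib]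

/-- The difference of the quadratures of `g` over the two faces orthogonal to direction `d`. -/
def bdryQuad (ξ : Fin (N + 1) → ℝ) (d : Fin 3) (g : Node N → ℝ) : ℝ :=
  ∑ ab : Fin (N + 1) × Fin (N + 1), weight ξ ab.1 * weight ξ ab.2 *
    (g (faceNode (d, true) ab) - g (faceNode (d, false) ab))

theorem sum_bdryQuad (g : Fin 3 → Node N → ℝ) :
    ∑ d, bdryQuad ξ d (g d) = surfQuad ξ (fun f ab => f.side * g f.1 (faceNode f ab)) := by
  rw [surfQuad, Fintype.sum_prod_type]
  refine Finset.sum_congr rfl fun d _ => ?_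
  rw [Fintype.sum_bool, bdryQuad, ← Finset.sum_add_distrib]
  refine Finset.sum_congr rfl fun ab _ => ?_
  simp [Face.side]
  ring

/-- Summation by parts for a two-point function `T` along the grid lines in direction `d`. -/
theorem volQuad_sbp (hN : 1 ≤ N) (hξ : IsLGL N ξ) (d : Fin 3) (T : Node N → Node N → ℝ) :
    volQuad ξ (fun p => ∑ m, derMatrix ξ (p d) m * T p (Function.update p d m))
      + volQuad ξ (fun p => ∑ m, derMatrix ξ (p d) m * T (Function.update p d m) p)
      = bdryQuad ξ d (fun p => T p p) := by
  rw [volQuad_eq_sum_lines ξ d, volQuad_eq_sum_lines ξ d, bdryQuad, ← Finset.sum_add_distrib]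
  refine Finset.sum_congr rfl fun ab _ => ?_
  rw [← mul_add]
  congr 1
  simp only [lineNode_self, update_lineNode, Finset.mul_sum, faceNode_eq_lineNode]
  conv_lhs =>
    congr
    · skip
    · rw [Finset.sum_comm]
  simp only [← Finset.sum_add_distrib]
  have h : ∀ i m, weight ξ i * (derMatrix ξ i m * T (lineNode d ab i) (lineNode d ab m))
      + weight ξ m * (derMatrix ξ m i * T (lineNode d ab i) (lineNode d ab m))
      = ((if i = Fin.last N ∧ m = Fin.last N then 1 else 0) - (if i = 0 ∧ m = 0 then 1 else 0))
        * T (lineNode d ab i) (lineNode d ab m) := fun i m => by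
    rw [← hξ.summation_by_parts hN i m]; ring
  simp only [h, sub_mul, Finset.sum_sub_distrib, ite_and, ite_mul, one_mul, zero_mul]
  simp

/-- Summation by parts for a difference of `χ` weighted with the mean of `b`, a split form of the
product rule. -/
theorem volQuad_split (hN : 1 ≤ N) (hξ : IsLGL N ξ) (d : Fin 3) (b χ : Node N → ℝ) :
    volQuad ξ (fun p => ∑ m, derMatrix ξ (p d) m * (avg (b p) (b (Function.update p d m))
        * (χ p - χ (Function.update p d m))))
      = volQuad ξ (fun p => χ p * nodalDeriv ξ d b p) - bdryQuad ξ d (fun p => b p * χ p) := by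
  have h1 := volQuad_sbp hN hξ d fun p q => b q * χ p
  have h2 := volQuad_sbp hN hξ d fun p _ => b p * χ p
  have h3 : volQuad ξ (fun p => ∑ m, derMatrix ξ (p d) m * (b p * χ p)) = 0 := by
    simp [← Finset.sum_mul, hξ.sum_derMatrix, volQuad]
  have h4 : volQuad ξ (fun p => χ p * nodalDeriv ξ d b p)
      = volQuad ξ (fun p => ∑ m, derMatrix ξ (p d) m * (b (Function.update p d m) * χ p)) := by
    refine congrArg _ (funext fun p => ?_)
    rw [nodalDeriv, Finset.mul_sum]
    exact Finset.sum_congr rfl fun m _ => by ring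
  have h5 : volQuad ξ (fun p => ∑ m, derMatrix ξ (p d) m * (avg (b p) (b (Function.update p d m))
        * (χ p - χ (Function.update p d m))))
      = 1 / 2 * (volQuad ξ (fun p => ∑ m, derMatrix ξ (p d) m * (b p * χ p))
        - volQuad ξ (fun p => ∑ m, derMatrix ξ (p d) m * (b p * χ (Function.update p d m)))
        + volQuad ξ (fun p => ∑ m, derMatrix ξ (p d) m * (b (Function.update p d m) * χ p))
        - volQuad ξ (fun p => ∑ m, derMatrix ξ (p d) m *
            (b (Function.update p d m) * χ (Function.update p d m)))) := by
    rw [← volQuad_sub, ← volQuad_add, ← volQuad_sub, ← volQuad_const_mul]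
    refine congrArg _ (funext fun p => ?_)
    rw [← Finset.sum_sub_distrib, ← Finset.sum_add_distrib, ← Finset.sum_sub_distrib,
      Finset.mul_sum]
    exact Finset.sum_congr rfl fun m _ => by rw [avg]; ring
  rw [h5, h4]
  linarith

/-- Telescoping of the volume terms. If the antisymmetric part of the two-point function `T d` is
the mean of the metric terms times a difference of potentials, and the metric terms are
discretely divergence free, then the flux differencing sum reduces to the boundary. -/
theorem volQuad_fluxDiff (hN : 1 ≤ N) (hξ : IsLGL N ξ) (a : Node N → Fin 3 → Vec3)
    (ha : ∀ p n, ∑ d, nodalDeriv ξ d (fun q => a q d n) p = 0)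
    (T : Fin 3 → Node N → Node N → ℝ) (χ : Node N → Vec3)
    (hT : ∀ d p q, T d p q - T d q p
      = 2 * ∑ n, avg (a p d n) (a q d n) * (χ p n - χ q n)) :
    volQuad ξ (fun p => ∑ d, ∑ m, derMatrix ξ (p d) m * T d p (Function.update p d m))
      = surfQuad ξ (fun f ab => f.side * (1 / 2 * T f.1 (faceNode f ab) (faceNode f ab)
          - ∑ n, a (faceNode f ab) f.1 n * χ (faceNode f ab) n)) := by
  have hd : ∀ d, volQuad ξ (fun p => ∑ m, derMatrix ξ (p d) m * T d p (Function.update p d m))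
      = bdryQuad ξ d (fun p => 1 / 2 * T d p p - ∑ n, a p d n * χ p n)
        + volQuad ξ (fun p => ∑ n, χ p n * nodalDeriv ξ d (fun q => a q d n) p) := fun d => by
    have h1 := volQuad_sbp hN hξ d (T d)
    have h2 := fun n => volQuad_split hN hξ d (fun q => a q d n) (fun q => χ q n)
    have h3 : volQuad ξ (fun p => ∑ m, derMatrix ξ (p d) m * T d p (Function.update p d m))
        - volQuad ξ (fun p => ∑ m, derMatrix ξ (p d) m * T d (Function.update p d m) p)
        = 2 * ∑ n, volQuad ξ (fun p => ∑ m, derMatrix ξ (p d) m *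
          (avg (a p d n) (a (Function.update p d m) d n)
            * (χ p n - χ (Function.update p d m) n))) := by
      rw [← volQuad_sub, ← volQuad_sum, ← volQuad_const_mul]
      refine congrArg _ (funext fun p => ?_)
      rw [← Finset.sum_sub_distrib, Finset.sum_comm, Finset.mul_sum]
      refine Finset.sum_congr rfl fun m _ => ?_
      rw [← mul_sub, hT, ← Finset.mul_sum]
      ring
    simp only [h2] at h3
    have h4 : bdryQuad ξ d (fun p => 1 / 2 * T d p p - ∑ n, a p d n * χ p n)
        = 1 / 2 * bdryQuad ξ d (fun p => T d p p)
          - ∑ n, bdryQuad ξ d (fun p => a p d n * χ p n) := by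
      simp only [bdryQuad]
      rw [Finset.sum_comm, Finset.mul_sum, ← Finset.sum_sub_distrib]
      refine Finset.sum_congr rfl fun ab _ => ?_
      rw [← Finset.mul_sum, Finset.sum_sub_distrib]
      ring
    have h6 : volQuad ξ (fun p => ∑ n, χ p n * nodalDeriv ξ d (fun q => a q d n) p) = _ :=
      volQuad_sum _ _
    rw [h4, h6]
    rw [Finset.sum_sub_distrib] at h3
    linarith
  rw [volQuad_sum, Finset.sum_congr rfl fun d _ => hd d, Finset.sum_add_distrib, sum_bdryQuad,
    ← volQuad_sum]
  have h0 : ∀ p, ∑ d, ∑ n, χ p n * nodalDeriv ξ d (fun q => a q d n) p = 0 := fun p => by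
    rw [Finset.sum_comm]
    exact Finset.sum_eq_zero fun n _ => by rw [← Finset.mul_sum, ha, mul_zero]
  simp [h0, volQuad]

/-! ### Discrete metric identities -/

theorem nodalDeriv_sub (d : Fin 3) (g h : Node N → ℝ) (p : Node N) :
    nodalDeriv ξ d (fun q => g q - h q) p = nodalDeriv ξ d g p - nodalDeriv ξ d h p := by
  simp only [nodalDeriv, mul_sub, Finset.sum_sub_distrib]

theorem nodalDeriv_neg (d : Fin 3) (g : Node N → ℝ) (p : Node N) :
    nodalDeriv ξ d (fun q => -g q) p = -nodalDeriv ξ d g p := by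
  simp only [nodalDeriv, mul_neg, Finset.sum_neg_distrib]

theorem nodalDeriv_comm {d e : Fin 3} (hde : d ≠ e) (g : Node N → ℝ) (p : Node N) :
    nodalDeriv ξ d (nodalDeriv ξ e g) p = nodalDeriv ξ e (nodalDeriv ξ d g) p := by
  simp only [nodalDeriv, Finset.mul_sum, Function.update_of_ne hde, Function.update_of_ne hde.symm]
  rw [Finset.sum_comm]
  refine Finset.sum_congr rfl fun m _ => Finset.sum_congr rfl fun k _ => ?_
  rw [Function.update_comm hde]
  ring

/-- The divergence of a discrete curl vanishes. -/
theorem sum_nodalDeriv_metric (X : Node N → Vec3) (p : Node N) (n : Fin 3) :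
    ∑ d, nodalDeriv ξ d (fun q => metric ξ X q d n) p = 0 := by
  simp only [metric, nodalDeriv_neg]
  rw [Fin.sum_univ_three]
  simp only [nodalDeriv_sub, Fin.isValue, zero_add, show (1 : Fin 3) + 1 = 2 from rfl,
    show (1 : Fin 3) + 2 = 0 from rfl, show (2 : Fin 3) + 1 = 0 from rfl,
    show (2 : Fin 3) + 2 = 1 from rfl]
  have c := fun (d e : Fin 3) (hde : d ≠ e) (g : Node N → ℝ) =>
    nodalDeriv_comm (ξ := ξ) hde g p
  have c10 := c 1 0 (by decide)
  have c20 := c 2 0 (by decide)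
  have c21 := c 2 1 (by decide)
  change -(nodalDeriv ξ 0 (nodalDeriv ξ 1 _) p - nodalDeriv ξ 0 (nodalDeriv ξ 2 _) p)
    + -(nodalDeriv ξ 1 (nodalDeriv ξ 2 _) p - nodalDeriv ξ 1 (nodalDeriv ξ 0 _) p)
    + -(nodalDeriv ξ 2 (nodalDeriv ξ 0 _) p - nodalDeriv ξ 2 (nodalDeriv ξ 1 _) p) = 0
  rw [c10, c20, c21]
  ring

/-! ### Metric terms on faces -/

/-- Derivative in the first coordinate of a face. -/
def faceDeriv₁ (ξ : Fin (N + 1) → ℝ) (g : Fin (N + 1) × Fin (N + 1) → ℝ)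
    (ab : Fin (N + 1) × Fin (N + 1)) : ℝ := ∑ m, derMatrix ξ ab.1 m * g (m, ab.2)

/-- Derivative in the second coordinate of a face. -/
def faceDeriv₂ (ξ : Fin (N + 1) → ℝ) (g : Fin (N + 1) × Fin (N + 1) → ℝ)
    (ab : Fin (N + 1) × Fin (N + 1)) : ℝ := ∑ m, derMatrix ξ ab.2 m * g (ab.1, m)

/-- The normal component of the discrete curl that defines the metric terms, as a function of the
positions `Y` of the nodes of a face. -/
def faceMetric (ξ : Fin (N + 1) → ℝ) (Y : Fin (N + 1) × Fin (N + 1) → Vec3)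
    (ab : Fin (N + 1) × Fin (N + 1)) : Vec3 := fun n =>
  -(faceDeriv₁ ξ (fun c => Y c (n + 2) * faceDeriv₂ ξ (fun c => Y c (n + 1)) c) ab
    - faceDeriv₂ ξ (fun c => Y c (n + 2) * faceDeriv₁ ξ (fun c => Y c (n + 1)) c) ab)

theorem nodalDeriv_faceNode₁ (f : Face) (g : Node N → ℝ) (ab : Fin (N + 1) × Fin (N + 1)) :
    nodalDeriv ξ (f.1 + 1) g (faceNode f ab) = faceDeriv₁ ξ (fun c => g (faceNode f c)) ab := by
  obtain ⟨d, s⟩ := f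
  have h : ∀ m, Function.update (faceNode (d, s) ab) (d + 1) m = faceNode (d, s) (m, ab.2) :=
    fun m => by funext e; fin_cases d <;> fin_cases e <;> simp [faceNode, Function.update]
  have h' : faceNode (d, s) ab (d + 1) = ab.1 := by fin_cases d <;> simp [faceNode]
  simp only [nodalDeriv, faceDeriv₁, h, h']

theorem nodalDeriv_faceNode₂ (f : Face) (g : Node N → ℝ) (ab : Fin (N + 1) × Fin (N + 1)) :
    nodalDeriv ξ (f.1 + 2) g (faceNode f ab) = faceDeriv₂ ξ (fun c => g (faceNode f c)) ab := by
  obtain ⟨d, s⟩ := f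
  have h : ∀ m, Function.update (faceNode (d, s) ab) (d + 2) m = faceNode (d, s) (ab.1, m) :=
    fun m => by funext e; fin_cases d <;> fin_cases e <;> simp [faceNode, Function.update]
  have h' : faceNode (d, s) ab (d + 2) = ab.2 := by fin_cases d <;> simp [faceNode]
  simp only [nodalDeriv, faceDeriv₂, h, h']

/-- Only tangential derivatives enter the metric terms on a face. -/
theorem metric_faceNode (X : Node N → Vec3) (f : Face) (ab : Fin (N + 1) × Fin (N + 1)) :
    metric ξ X (faceNode f ab) f.1 = faceMetric ξ (fun c => X (faceNode f c)) ab := by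
  funext n
  simp only [metric, covariant, faceMetric, nodalDeriv_faceNode₁, nodalDeriv_faceNode₂]

theorem faceDeriv_comm (g : Fin (N + 1) × Fin (N + 1) → ℝ) (ab : Fin (N + 1) × Fin (N + 1)) :
    faceDeriv₁ ξ (faceDeriv₂ ξ g) ab = faceDeriv₂ ξ (faceDeriv₁ ξ g) ab := by
  simp only [faceDeriv₁, faceDeriv₂, Finset.mul_sum]
  rw [Finset.sum_comm]
  exact Finset.sum_congr rfl fun m _ => Finset.sum_congr rfl fun k _ => by ring

theorem faceMetric_add_const (hξ : IsLGL N ξ) (Y : Fin (N + 1) × Fin (N + 1) → Vec3) (s : Vec3) :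
    faceMetric ξ (fun c => Y c + s) = faceMetric ξ Y := by
  funext ab n
  have h1 : ∀ (g : Fin (N + 1) × Fin (N + 1) → ℝ) (r : ℝ) c,
      faceDeriv₁ ξ (fun c => g c + r) c = faceDeriv₁ ξ g c := fun g r c => by
    simp only [faceDeriv₁, mul_add, Finset.sum_add_distrib, ← Finset.sum_mul, hξ.sum_derMatrix,
      zero_mul, add_zero]
  have h2 : ∀ (g : Fin (N + 1) × Fin (N + 1) → ℝ) (r : ℝ) c,
      faceDeriv₂ ξ (fun c => g c + r) c = faceDeriv₂ ξ g c := fun g r c => by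
    simp only [faceDeriv₂, mul_add, Finset.sum_add_distrib, ← Finset.sum_mul, hξ.sum_derMatrix,
      zero_mul, add_zero]
  have h3 : ∀ (g h : Fin (N + 1) × Fin (N + 1) → ℝ) (r : ℝ) c,
      faceDeriv₁ ξ (fun c => (g c + r) * h c) c
        = faceDeriv₁ ξ (fun c => g c * h c) c + r * faceDeriv₁ ξ h c := fun g h r c => by
    simp only [faceDeriv₁, Finset.mul_sum, ← Finset.sum_add_distrib]
    exact Finset.sum_congr rfl fun m _ => by ring
  have h4 : ∀ (g h : Fin (N + 1) × Fin (N + 1) → ℝ) (r : ℝ) c,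
      faceDeriv₂ ξ (fun c => (g c + r) * h c) c
        = faceDeriv₂ ξ (fun c => g c * h c) c + r * faceDeriv₂ ξ h c := fun g h r c => by
    simp only [faceDeriv₂, Finset.mul_sum, ← Finset.sum_add_distrib]
    exact Finset.sum_congr rfl fun m _ => by ring
  have h5 := faceDeriv_comm (ξ := ξ) (fun c => Y c (n + 1)) ab
  simp only [faceMetric, Pi.add_apply, h1, h2, h3, h4]
  change -(_ + s (n + 2) * faceDeriv₁ ξ (faceDeriv₂ ξ _) ab
    - (_ + s (n + 2) * faceDeriv₂ ξ (faceDeriv₁ ξ _) ab)) = _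
  rw [h5]
  ring

/-- Reversal of the first coordinate of a face. -/
def flipFst (c : Fin (N + 1) × Fin (N + 1)) : Fin (N + 1) × Fin (N + 1) := (Fin.rev c.1, c.2)

/-- Reversal of the second coordinate of a face. -/
def flipSnd (c : Fin (N + 1) × Fin (N + 1)) : Fin (N + 1) × Fin (N + 1) := (c.1, Fin.rev c.2)

theorem faceMetric_comp_swap (Y : Fin (N + 1) × Fin (N + 1) → Vec3)
    (ab : Fin (N + 1) × Fin (N + 1)) :
    faceMetric ξ (fun c => Y c.swap) ab = -faceMetric ξ Y ab.swap := by
  funext n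
  simp only [faceMetric, faceDeriv₁, faceDeriv₂, Prod.swap, Pi.neg_apply]
  ring

theorem faceMetric_comp_flipFst (hN : 1 ≤ N) (hξ : IsLGL N ξ)
    (Y : Fin (N + 1) × Fin (N + 1) → Vec3) (ab : Fin (N + 1) × Fin (N + 1)) :
    faceMetric ξ (fun c => Y (flipFst c)) ab = -faceMetric ξ Y (flipFst ab) := by
  have h1 : ∀ (g : Fin (N + 1) × Fin (N + 1) → ℝ) c,
      faceDeriv₁ ξ (fun c => g (flipFst c)) c = -faceDeriv₁ ξ g (flipFst c) := fun g c => by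
    simp only [faceDeriv₁, flipFst]
    rw [← Equiv.sum_comp Fin.revPerm, ← Finset.sum_neg_distrib]
    refine Finset.sum_congr rfl fun m _ => ?_
    have := hξ.derMatrix_rev hN c.1 (Fin.rev m)
    rw [Fin.rev_rev] at this
    simp only [Fin.revPerm_apply, Fin.rev_rev, this]
    ring
  have h2 : ∀ (g : Fin (N + 1) × Fin (N + 1) → ℝ) c,
      faceDeriv₂ ξ (fun c => g (flipFst c)) c = faceDeriv₂ ξ g (flipFst c) := fun g c => rfl
  have h3 : ∀ (g : Fin (N + 1) × Fin (N + 1) → ℝ) c,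
      faceDeriv₂ ξ (fun c => -g c) c = -faceDeriv₂ ξ g c := fun g c => by
    simp only [faceDeriv₂, mul_neg, Finset.sum_neg_distrib]
  funext n
  simp only [faceMetric, Pi.neg_apply, h1 (fun c => Y c (n + 1)), h2 (fun c => Y c (n + 1)),
    mul_neg, h3]
  rw [h1 (fun c => Y c (n + 2) * faceDeriv₂ ξ (fun c => Y c (n + 1)) c),
    h2 (fun c => Y c (n + 2) * faceDeriv₁ ξ (fun c => Y c (n + 1)) c)]
  ring

theorem faceMetric_comp_flipSnd (hN : 1 ≤ N) (hξ : IsLGL N ξ)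
    (Y : Fin (N + 1) × Fin (N + 1) → Vec3) (ab : Fin (N + 1) × Fin (N + 1)) :
    faceMetric ξ (fun c => Y (flipSnd c)) ab = -faceMetric ξ Y (flipSnd ab) := by
  have h1 := faceMetric_comp_swap (ξ := ξ) (fun c => Y (flipSnd c)) ab.swap
  have h2 := faceMetric_comp_flipFst hN hξ (fun c => Y c.swap) ab.swap
  have h3 := faceMetric_comp_swap (ξ := ξ) Y (flipFst ab.swap)
  have h4 : (fun c => Y (flipSnd (Prod.swap c))) = fun c => Y (flipFst c).swap := rfl
  rw [h4, h2, h3, Prod.swap_swap] at h1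
  rw [← neg_eq_iff_eq_neg.mpr h1, neg_neg]
  rfl

/-- The metric terms of a face change by the determinant of the symmetry under reorientation. -/
theorem faceMetric_comp_act (hN : 1 ≤ N) (hξ : IsLGL N ξ) (o : FaceOrientation)
    (Y : Fin (N + 1) × Fin (N + 1) → Vec3) (ab : Fin (N + 1) × Fin (N + 1)) :
    faceMetric ξ (fun c => Y (o.act c)) ab = o.det • faceMetric ξ Y (o.act ab) := by
  have hs := fun Y ab => faceMetric_comp_swap (N := N) (ξ := ξ) Y ab
  have h1 := fun Y ab => faceMetric_comp_flipFst hN hξ Y ab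
  have h2 := fun Y ab => faceMetric_comp_flipSnd hN hξ Y ab
  obtain ⟨s, a, b⟩ := o
  have hact : ∀ c : Fin (N + 1) × Fin (N + 1), (FaceOrientation.mk s a b).act c
      = (if a then flipFst else id) ((if b then flipSnd else id)
        ((if s then Prod.swap else id) c)) := by
    intro c
    cases s <;> cases a <;> cases b <;> rfl
  simp only [hact]
  have e1 : ∀ (Y : Fin (N + 1) × Fin (N + 1) → Vec3) c,
      faceMetric ξ (fun c => Y ((if s then Prod.swap else id) c)) c
      = (if s then (-1 : ℝ) else 1) • faceMetric ξ Y ((if s then Prod.swap else id) c) := by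
    intro Y c
    cases s
    · simp
    · simpa using hs Y c
  have e2 : ∀ (Y : Fin (N + 1) × Fin (N + 1) → Vec3) c,
      faceMetric ξ (fun c => Y ((if a then flipFst else id) c)) c
      = (if a then (-1 : ℝ) else 1) • faceMetric ξ Y ((if a then flipFst else id) c) := by
    intro Y c
    cases a
    · simp
    · simpa using h1 Y c
  have e3 : ∀ (Y : Fin (N + 1) × Fin (N + 1) → Vec3) c,
      faceMetric ξ (fun c => Y ((if b then flipSnd else id) c)) c
      = (if b then (-1 : ℝ) else 1) • faceMetric ξ Y ((if b then flipSnd else id) c) := by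
    intro Y c
    cases b
    · simp
    · simpa using h2 Y c
  rw [e1 (fun c => Y ((if a then flipFst else id) ((if b then flipSnd else id) c))),
    e3 (fun c => Y ((if a then flipFst else id) c)), e2, smul_smul, smul_smul]
  congr 1
  simp only [FaceOrientation.det]
  ring

/-! ### Pointwise identities for the two-point flux -/

theorem avg_comm (a b : ℝ) : avg a b = avg b a := by
  rw [avg, avg, add_comm]

theorem avg_self (a : ℝ) : avg a a = a := by
  rw [avg]; ring

theorem logMean_comm (a b : ℝ) : logMean a b = logMean b a := by
  unfold logMean
  by_cases h : a = b
  · simp [h]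
  · rw [if_neg h, if_neg (Ne.symm h), ← neg_sub a b, ← neg_sub (Real.log a), neg_div_neg_eq]

theorem logMean_self (a : ℝ) : logMean a a = a := if_pos rfl

theorem log_sub_log_ne_zero {a b : ℝ} (ha : 0 < a) (hb : 0 < b) (h : a ≠ b) :
    Real.log b - Real.log a ≠ 0 :=
  sub_ne_zero.mpr fun h' => h (Real.log_injOn_pos ha hb h'.symm)

theorem log_sub_log_mul_logMean {a b : ℝ} (ha : 0 < a) (hb : 0 < b) :
    (Real.log a - Real.log b) * logMean a b = a - b := by
  by_cases h : a = b
  · simp [h]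
  · have h' := log_sub_log_ne_zero ha hb h
    rw [logMean, if_neg h]
    field_simp
    ring

theorem logMean_ne_zero {a b : ℝ} (ha : 0 < a) (hb : 0 < b) : logMean a b ≠ 0 := by
  by_cases h : a = b
  · rw [h, logMean_self]; exact hb.ne'
  · rw [logMean, if_neg h]
    exact div_ne_zero (sub_ne_zero.mpr (Ne.symm h)) (log_sub_log_ne_zero ha hb h)

theorem ecFlux_comm (P : Params) (uL uR : State) : ecFlux P uL uR = ecFlux P uR uL := by
  have h : ∀ f, avgOf f uL uR = avgOf f uR uL := fun f => avg_comm _ _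
  have hρ : ∀ l, ecDens uL uR l = ecDens uR uL l := fun l => by
    rw [ecDens, ecDens, logMean_comm, h]
  have hm : ∀ l c, ecMom P uL uR l c = ecMom P uR uL l c := fun l c => by
    simp only [ecMom, hρ, h]
  have hB : ∀ l c, ecMag P uL uR l c = ecMag P uR uL l c := fun l c => by
    simp only [ecMag, h]
  have hψ : ∀ l, ecPsi P uL uR l = ecPsi P uR uL l := fun l => by
    simp only [ecPsi, h]
  funext l
  have hE : ecEnergy P uL uR l = ecEnergy P uR uL l := by
    simp only [ecEnergy, hρ, hm, hB, hψ, h, logMean_comm (beta P uL)]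
  simp only [ecFlux, hE, hρ, hψ, funext (hm l), funext (hB l)]

theorem dotProduct_mkState (w : State) (a : ℝ) (m : Vec3) (e : ℝ) (b : Vec3) (s : ℝ) :
    w ⬝ᵥ mkState a m e b s = w 0 * a + (w 1 * m 0 + w 2 * m 1 + w 3 * m 2) + w 4 * e
      + (w 5 * b 0 + w 6 * b 1 + w 7 * b 2) + w 8 * s := by
  simp [dotProduct, mkState, Fin.sum_univ_succ]
  ring

/-- States at which density and pressure are positive. -/
def Admissible (P : Params) (u : State) : Prop := 0 < dens u ∧ 0 < pressure P u

theorem Admissible.beta_pos {P : Params} {u : State} (h : Admissible P u) : 0 < beta P u :=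
  div_pos h.1 (mul_pos two_pos h.2)

theorem Admissible.thermoEntropy_eq {P : Params} {u : State} (h : Admissible P u) :
    thermoEntropy P u = Real.log (pressure P u) - P.γ * Real.log (dens u) := by
  rw [thermoEntropy, Real.log_mul h.2.ne' (Real.rpow_pos_of_pos h.1 _).ne', Real.log_rpow h.1]
  ring

theorem Admissible.thermoEntropy_eq_beta {P : Params} {u : State} (h : Admissible P u) :
    thermoEntropy P u = (1 - P.γ) * Real.log (dens u) - Real.log (beta P u) - Real.log 2 := by
  rw [h.thermoEntropy_eq, beta, Real.log_div h.1.ne' (mul_pos two_pos h.2).ne',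
    Real.log_mul two_ne_zero h.2.ne']
  ring

/-- The contraction of the entropy variables with the Powell vector. -/
def powellPot (P : Params) (u : State) : ℝ := 2 * beta P u * (vel u ⬝ᵥ mag u)

/-- The entropy flux potential `w · f_l - F_l + θ B_l` of the advective flux, with entropy flux
`F = S v` and `θ` the contraction of the entropy variables with the Powell vector. -/
def entropyPot (P : Params) (u : State) : Vec3 := fun l =>
  dens u * vel u l + beta P u * vel u l * (mag u ⬝ᵥ mag u) + 2 * beta P u * P.ch * psi u * mag u l

theorem entropyVars_dot_powell (P : Params) (u : State) :
    entropyVars P u ⬝ᵥ powell u = powellPot P u := by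
  rw [powell, dotProduct_mkState, powellPot]
  simp [entropyVars, mkState, dotProduct, Fin.sum_univ_three]
  ring

theorem entropyVars_dot_phiGLM (P : Params) (u : State) (l : Fin 3) :
    entropyVars P u ⬝ᵥ phiGLM u l = 0 := by
  rw [phiGLM, dotProduct_mkState]
  simp [entropyVars, mkState]
  ring

theorem entropyVars_dot_source_nonpos {P : Params} {u : State} (hα : 0 ≤ P.α)
    (h : Admissible P u) : entropyVars P u ⬝ᵥ source P u ≤ 0 := by
  have : 0 ≤ beta P u * P.α * psi u ^ 2 :=
    mul_nonneg (mul_nonneg h.beta_pos.le hα) (sq_nonneg _)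
  rw [source, dotProduct_mkState]
  simp [entropyVars, mkState]
  linarith

/-- The discrete entropy condition of the two-point flux. Its non-conservative part is
compensated by the Powell term. -/
theorem ecFlux_entropy_condition {P : Params} (hγ : 1 < P.γ) {uL uR : State}
    (hL : Admissible P uL) (hR : Admissible P uR) (l : Fin 3) :
    entropyVars P uL ⬝ᵥ ecFlux P uL uR l - entropyVars P uR ⬝ᵥ ecFlux P uL uR l
      = entropyPot P uL l - entropyPot P uR l
        - avg (mag uL l) (mag uR l) * (powellPot P uL - powellPot P uR) := by
  have hγ' : P.γ - 1 ≠ 0 := by linarith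
  have hρ := log_sub_log_mul_logMean hL.1 hR.1
  have hβ := log_sub_log_mul_logMean hL.beta_pos hR.beta_pos
  have hβ0 := logMean_ne_zero hL.beta_pos hR.beta_pos
  have hβ' : 1 / (2 * (P.γ - 1) * logMean (beta P uL) (beta P uR)) * (beta P uL - beta P uR)
      = (Real.log (beta P uL) - Real.log (beta P uR)) / (2 * (P.γ - 1)) := by
    rw [← hβ]; field_simp
  have hp : avg (dens uL) (dens uR) / (2 * avg (beta P uL) (beta P uR))
      * (beta P uL + beta P uR) = avg (dens uL) (dens uR) := by
    have h1 := hL.beta_pos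
    have h2 := hR.beta_pos
    have h3 : 2 * avg (beta P uL) (beta P uR) = beta P uL + beta P uR := by rw [avg]; ring
    rw [h3, div_mul_cancel₀ _ (by positivity)]
  have hw : ∀ {u}, Admissible P u → entropyVars P u 0 = Real.log (dens u)
      + (P.γ + Real.log (beta P u) + Real.log 2) * (1 / (P.γ - 1))
      - beta P u * (vel u ⬝ᵥ vel u) := by
    intro u hu
    have : entropyVars P u 0
        = (P.γ - thermoEntropy P u) / (P.γ - 1) - beta P u * (vel u ⬝ᵥ vel u) := rfl
    rw [this, hu.thermoEntropy_eq_beta]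
    field_simp
    ring
  have hw' : ∀ u, entropyVars P u 1 = 2 * beta P u * vel u 0 ∧
      entropyVars P u 2 = 2 * beta P u * vel u 1 ∧ entropyVars P u 3 = 2 * beta P u * vel u 2 ∧
      entropyVars P u 4 = -(2 * beta P u) ∧ entropyVars P u 5 = 2 * beta P u * mag u 0 ∧
      entropyVars P u 6 = 2 * beta P u * mag u 1 ∧ entropyVars P u 7 = 2 * beta P u * mag u 2 ∧
      entropyVars P u 8 = 2 * beta P u * psi u :=
    fun u => ⟨rfl, rfl, rfl, rfl, rfl, rfl, rfl, rfl⟩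
  simp only [ecFlux, dotProduct_mkState, hw hL, hw hR, hw' uL, hw' uR, ecEnergy, ecMom, ecMag,
    ecPsi, avgOf, entropyPot, powellPot, Fin.sum_univ_three]
  simp only [dotProduct, Fin.sum_univ_three]
  -- The density flux is kept as an atom except where it meets the logarithm of the density.
  have hf : (Real.log (dens uL) - Real.log (dens uR)) * ecDens uL uR l
      = (dens uL - dens uR) * avg (vel uL l) (vel uR l) := by
    rw [ecDens, ← hρ, avgOf]; ring
  have hβ'' : 1 / (2 * (P.γ - 1) * logMean (beta P uL) (beta P uR)) * (beta P uL - beta P uR)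
      = (Real.log (beta P uL) - Real.log (beta P uR)) * (1 / (P.γ - 1)) / 2 := by
    rw [hβ']; field_simp
  generalize ecDens uL uR l = fr at *
  generalize 1 / (2 * (P.γ - 1) * logMean (beta P uL) (beta P uR)) = a at *
  generalize 1 / (P.γ - 1) = g at *
  generalize avg (dens uL) (dens uR) / (2 * avg (beta P uL) (beta P uR)) = q at *
  simp only [avg] at *
  generalize Real.log (dens uL) = lρL at *
  generalize Real.log (dens uR) = lρR at *
  generalize Real.log (beta P uL) = lβL at *
  generalize Real.log (beta P uR) = lβR at *
  generalize dens uL = ρL at *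
  generalize dens uR = ρR at *
  generalize beta P uL = βL at *
  generalize beta P uR = βR at *
  generalize vel uL = vL at *
  generalize vel uR = vR at *
  generalize mag uL = BL at *
  generalize mag uR = BR at *
  generalize psi uL = ψL at *
  generalize psi uR = ψR at *
  clear hρ hβ hβ0 hw hw' hβ' hγ hL hR hγ'
  -- The pressure mean contributes through `hp`, with the jump of the normal velocity as factor.
  fin_cases l <;> simp [kron] at * <;>
    first
    | linear_combination hf - 2 * fr * hβ'' + (vL 0 - vR 0) * hp
    | linear_combination hf - 2 * fr * hβ'' + (vL 1 - vR 1) * hp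
    | linear_combination hf - 2 * fr * hβ'' + (vL 2 - vR 2) * hp

theorem ecFlux_self {P : Params} (hγ : 1 < P.γ) {u : State} (h : Admissible P u) :
    ecFlux P u u = advFlux P u := by
  have hγ' : P.γ - 1 ≠ 0 := by linarith
  have hρ := h.1.ne'
  have hp := h.2.ne'
  have hb : dens u / (2 * beta P u) = pressure P u := by
    rw [beta]; field_simp
  have hb' : dens u * (1 / (2 * (P.γ - 1) * beta P u)) = pressure P u / (P.γ - 1) := by
    rw [← hb]; field_simp [h.beta_pos.ne']
  have hg : P.γ * pressure P u / (P.γ - 1) = pressure P u + pressure P u / (P.γ - 1) := by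
    field_simp; ring
  funext l
  have hE : ecEnergy P u u l = vel u l * (1 / 2 * dens u * (vel u ⬝ᵥ vel u)
      + P.γ * pressure P u / (P.γ - 1)) + (vel u l * (mag u ⬝ᵥ mag u)
      - mag u l * (vel u ⬝ᵥ mag u)) + P.ch * psi u * mag u l := by
    rw [hg]
    simp only [ecEnergy, ecMom, ecMag, ecPsi, ecDens, avgOf, avg_self, logMean_self, hb,
      Fin.sum_univ_three, dotProduct]
    generalize 1 / (2 * (P.γ - 1) * beta P u) = a at *
    generalize pressure P u / (P.γ - 1) = b at *
    fin_cases l <;> simp [kron] <;>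
    first
    | linear_combination vel u 0 * hb'
    | linear_combination vel u 1 * hb'
    | linear_combination vel u 2 * hb'
  have hm : ∀ c, ecMom P u u l c = dens u * vel u l * vel u c + pressure P u * kron l c
      + (1 / 2 * (mag u ⬝ᵥ mag u) * kron l c - mag u l * mag u c) := fun c => by
    simp only [ecMom, ecDens, avgOf, avg_self, logMean_self, hb, dotProduct]
    ring
  have hB : ∀ c, ecMag P u u l c = vel u l * mag u c - mag u l * vel u c
      + P.ch * psi u * kron l c := fun c => by
    simp only [ecMag, avgOf, avg_self]
    ring
  simp only [ecFlux, advFlux, fluxEuler, fluxMHD, fluxGLM, hE, ecDens, ecPsi, avgOf, avg_self,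
    logMean_self, mkState, hm, hB]
  ext i
  fin_cases i <;> simp

/-! ### Dissipation of the viscous and resistive fluxes -/

/-- The viscous dissipation: the trace-free part of the symmetric gradient appears squared. -/
theorem stress_contract_nonneg {P : Params} (hμ : 0 ≤ P.μNS) (G : Fin 3 → Vec3) :
    0 ≤ ∑ k, ∑ l, stress P G k l * G l k := by
  have h : ∑ k, ∑ l, stress P G k l * G l k = P.μNS *
      ((G 0 1 + G 1 0) ^ 2 + (G 0 2 + G 2 0) ^ 2 + (G 1 2 + G 2 1) ^ 2
        + 2 / 3 * ((G 0 0 - G 1 1) ^ 2 + (G 0 0 - G 2 2) ^ 2 + (G 1 1 - G 2 2) ^ 2)) := by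
    simp [Fin.sum_univ_three, stress, kron]
    ring
  rw [h]
  positivity

/-- The viscous flux contracted with the gradient of the entropy variables: the work of the
stress and of the Lorentz force in the energy flux cancels, and squares remain. -/
theorem sum_dot_viscFlux_nonneg {P : Params} (hμ : 0 ≤ P.μNS) (hμR : 0 ≤ P.μR) (hκ : 0 ≤ P.κ)
    (hR : 0 < P.R) {u : State} (h : Admissible P u) (q : Block) :
    0 ≤ ∑ k, q k ⬝ᵥ viscFlux P u q k := by
  have hβ := h.beta_pos
  set β := beta P u with hβdef
  set Gv := gradVel P u q with hGv
  set GB := gradMag P u q with hGB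
  have hw4 : entropyVars P u 4 = -(2 * β) := rfl
  have hv : ∀ l k, ![q k 1, q k 2, q k 3] l = 2 * β * Gv l k - vel u l * q k 4 := fun l k => by
    have h1 : Gv l k = (2 * β * vel u l) / (-(2 * β)) ^ 2 * q k 4
        - 1 / (-(2 * β)) * ![q k 1, q k 2, q k 3] l := by
      fin_cases l <;> rfl
    rw [h1]
    field_simp
    ring
  have hB : ∀ l k, ![q k 5, q k 6, q k 7] l = 2 * β * GB l k - mag u l * q k 4 := fun l k => by
    have h1 : GB l k = (2 * β * mag u l) / (-(2 * β)) ^ 2 * q k 4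
        - 1 / (-(2 * β)) * ![q k 5, q k 6, q k 7] l := by
      fin_cases l <;> rfl
    rw [h1]
    field_simp
    ring
  have hv0 := fun k => hv 0 k
  have hv1 := fun k => hv 1 k
  have hv2 := fun k => hv 2 k
  have hB0 := fun k => hB 0 k
  have hB1 := fun k => hB 1 k
  have hB2 := fun k => hB 2 k
  simp only [Matrix.cons_val_zero, Matrix.cons_val_one, Matrix.cons_val] at hv0 hv1 hv2 hB0 hB1 hB2
  have key : ∑ k, q k ⬝ᵥ viscFlux P u q k = 2 * β * ∑ k, ∑ l, stress P Gv k l * Gv l k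
      + P.κ / P.R * ∑ k, 1 / (2 * β) ^ 2 * q k 4 ^ 2
      + 2 * β * P.μR * ((GB 0 1 - GB 1 0) ^ 2 + (GB 0 2 - GB 2 0) ^ 2 + (GB 1 2 - GB 2 1) ^ 2) := by
    have hT : ∀ k, gradTemp P u q k = 1 / (2 * β) ^ 2 * q k 4 := fun k => by
      rw [gradTemp, hw4, neg_sq]
    simp only [viscFlux, viscFluxPhys, dotProduct_mkState, ← hGv, ← hGB, hT]
    simp only [hv0, hv1, hv2, hB0, hB1, hB2, Fin.sum_univ_three, crossProduct]
    generalize stress P Gv = τ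
    generalize 1 / (2 * β) ^ 2 = b
    simp [curlOf]
    ring
  rw [key]
  have h1 := stress_contract_nonneg hμ Gv
  have h2 : 0 ≤ P.κ / P.R := div_nonneg hκ hR.le
  positivity

/-! ### Time derivative of the entropy -/

theorem hasDerivWithinAt_entropy {P : Params} (hγ : 1 < P.γ) {I : Set ℝ} {t : ℝ} (ht : t ∈ I)
    {u : ℝ → State} {u' : State} (hu : ∀ c, HasDerivWithinAt (fun s => u s c) (u' c) I t)
    (hadm : ∀ s ∈ I, Admissible P (u s)) :
    HasDerivWithinAt (fun s => entropy P (u s)) (u' ⬝ᵥ entropyVars P (u t)) I t := by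
  have hγ' : P.γ - 1 ≠ 0 := by linarith
  have hρ : u t 0 ≠ 0 := (hadm t ht).1.ne'
  have hp : pressure P (u t) ≠ 0 := (hadm t ht).2.ne'
  have hpress : HasDerivWithinAt (fun s => pressure P (u s)) ((P.γ - 1) * (u' 4
      - (vel (u t) 0 * u' 1 + vel (u t) 1 * u' 2 + vel (u t) 2 * u' 3)
      + 1 / 2 * (vel (u t) ⬝ᵥ vel (u t)) * u' 0
      - (u t 5 * u' 5 + u t 6 * u' 6 + u t 7 * u' 7) - u t 8 * u' 8)) I t := by
    have hd := ((((hu 4).sub (((hu 0).const_mul (1 / 2)).mul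
      (((((hu 1).div (hu 0) hρ).pow 2).add (((hu 2).div (hu 0) hρ).pow 2)).add
        (((hu 3).div (hu 0) hρ).pow 2)))).sub
      (((((hu 5).pow 2).add ((hu 6).pow 2)).add ((hu 7).pow 2)).const_mul (1 / 2))).sub
      (((hu 8).pow 2).const_mul (1 / 2))).const_mul (P.γ - 1)
    refine (hd.congr_deriv ?_).congr_of_mem (fun s _ => ?_) ht
    · simp [vel, dotProduct, Fin.sum_univ_three, -mul_eq_mul_left_iff]
      field_simp
      ring
    · simp [pressure, energy, dens, vel, mag, psi, dotProduct, Fin.sum_univ_three,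
        -mul_eq_mul_left_iff]
      ring
  have hS := (((hu 0).mul ((hpress.log hp).sub (((hu 0).log hρ).const_mul P.γ))).neg).div_const
    (P.γ - 1)
  refine (hS.congr_deriv ?_).congr_of_mem (fun s hs => ?_) ht
  · have hs := (hadm t ht).thermoEntropy_eq
    have hdot : u' ⬝ᵥ entropyVars P (u t) = u' ⬝ᵥ mkState _ _ _ _ _ := rfl
    rw [hdot, dotProduct_mkState, hs]
    simp [beta, dens, mag, psi, dotProduct, Fin.sum_univ_three]
    field_simp
    ring
  · simp [entropy, (hadm s hs).thermoEntropy_eq, dens]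

/-! ### Area vectors and cancellation at interfaces -/

theorem dotProduct_dotBlock (w : State) (g : Vec3) (F : Block) :
    w ⬝ᵥ dotBlock g F = ∑ n, g n * (w ⬝ᵥ F n) := by
  simp only [dotBlock, dotProduct_sum, dotProduct_smul, smul_eq_mul]

/-- The outward normal times the surface element. A junk value of the normal at a vanishing
surface element does no harm, since the metric terms then vanish as well. -/
theorem surfElem_mul_normal (X : Node N → Vec3) (f : Face) (ab : Fin (N + 1) × Fin (N + 1))
    (n : Fin 3) :
    normal ξ X f ab n * surfElem ξ X f ab = f.side * metric ξ X (faceNode f ab) f.1 n := by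
  by_cases h : surfElem ξ X f ab = 0
  · have h0 : metric ξ X (faceNode f ab) f.1 = 0 := by
      have hnn : 0 ≤ metric ξ X (faceNode f ab) f.1 ⬝ᵥ metric ξ X (faceNode f ab) f.1 :=
        Finset.sum_nonneg fun _ _ => mul_self_nonneg _
      exact dotProduct_self_eq_zero.mp ((Real.sqrt_eq_zero hnn).mp h)
    rw [h, h0]
    simp
  · simp only [normal, Pi.smul_apply, smul_eq_mul]
    field_simp

namespace PeriodicMesh

variable {Elem : Type*}

/-- The outward area vector at a face node: the outward normal times the surface element. -/
def areaVec (M : PeriodicMesh N ξ Elem) (ν : Elem) (f : Face)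
    (ab : Fin (N + 1) × Fin (N + 1)) : Vec3 := fun n => f.side * M.Ja ν (faceNode f ab) f.1 n

theorem dotProduct_normal_mul_surfElem (M : PeriodicMesh N ξ Elem) (ν : Elem) (f : Face)
    (ab : Fin (N + 1) × Fin (N + 1)) (g : Vec3) :
    (∑ n, normal ξ (M.X ν) f ab n * g n) * surfElem ξ (M.X ν) f ab
      = ∑ n, M.areaVec ν f ab n * g n := by
  rw [Finset.sum_mul]
  refine Finset.sum_congr rfl fun n _ => ?_
  rw [areaVec, Ja, ← surfElem_mul_normal]
  ring

/-- The mesh is watertight: the area vectors on the two sides of an interface are opposite. -/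
theorem areaVec_nbr (hN : 1 ≤ N) (hξ : IsLGL N ξ) (M : PeriodicMesh N ξ Elem) (ν : Elem)
    (f : Face) (ab : Fin (N + 1) × Fin (N + 1)) :
    M.areaVec (M.nbr (ν, f)).1 (M.nbr (ν, f)).2 ((M.orient (ν, f)).act ab)
      = -M.areaVec ν f ab := by
  set F' := M.nbr (ν, f) with hF'
  set o := M.orient (ν, f) with ho
  have h1 := faceMetric_comp_act hN hξ o (fun c => M.X F'.1 (faceNode F'.2 c)) ab
  have h2 : (fun c => M.X F'.1 (faceNode F'.2 (o.act c)))
      = fun c => M.X ν (faceNode f c) + M.shift (ν, f) := funext (M.conforming (ν, f))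
  rw [h2, faceMetric_add_const hξ, ← metric_faceNode, ← metric_faceNode, M.orient_det] at h1
  have hs : f.side * f.side = 1 := by
    rcases f with ⟨d, s⟩; cases s <;> norm_num [Face.side]
  funext n
  have h3 := congrFun h1 n
  simp only [Pi.smul_apply, smul_eq_mul, ← hF'] at h3
  simp only [areaVec, Ja, Pi.neg_apply, h3]
  linear_combination
    -(Face.side F'.2 * metric ξ (M.X F'.1) (faceNode F'.2 (o.act ab)) F'.2.1 n) * hs

theorem sec_nbr {V : Type*} (M : PeriodicMesh N ξ Elem) (Y : Elem → Node N → V) (ν : Elem)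
    (f : Face) (ab : Fin (N + 1) × Fin (N + 1)) :
    M.sec Y (M.nbr (ν, f)).1 (M.nbr (ν, f)).2 ((M.orient (ν, f)).act ab) = M.prim Y ν f ab := by
  simp only [sec, prim, Prod.mk.eta, M.nbr_nbr, M.orient_nbr]

/-- The passage of a face node to the other side of the interface. -/
def acrossPerm (M : PeriodicMesh N ξ Elem) :
    Equiv.Perm ((Elem × Face) × (Fin (N + 1) × Fin (N + 1))) :=
  Function.Involutive.toPerm (fun x => (M.nbr x.1, (M.orient x.1).act x.2)) fun x => by
    simp only [M.nbr_nbr, M.orient_nbr]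

theorem weight_act (hN : 1 ≤ N) (hξ : IsLGL N ξ) (o : FaceOrientation)
    (ab : Fin (N + 1) × Fin (N + 1)) :
    weight ξ (o.act ab).1 * weight ξ (o.act ab).2 = weight ξ ab.1 * weight ξ ab.2 := by
  obtain ⟨s, a, b⟩ := o
  cases s <;> cases a <;> cases b <;>
    simp [FaceOrientation.act, hξ.weight_rev hN, mul_comm]

theorem sum_surfQuad_eq_zero [Fintype Elem] (hN : 1 ≤ N) (hξ : IsLGL N ξ)
    (M : PeriodicMesh N ξ Elem) (g : Elem → Face → Fin (N + 1) × Fin (N + 1) → ℝ)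
    (hg : ∀ ν f ab, g ν f ab + g (M.nbr (ν, f)).1 (M.nbr (ν, f)).2 ((M.orient (ν, f)).act ab) = 0) :
    ∑ ν, surfQuad ξ (g ν) = 0 := by
  let G : (Elem × Face) × (Fin (N + 1) × Fin (N + 1)) → ℝ := fun x =>
    weight ξ x.2.1 * weight ξ x.2.2 * g x.1.1 x.1.2 x.2
  have h1 : ∑ ν, surfQuad ξ (g ν) = ∑ x, G x := by
    simp only [surfQuad, Fintype.sum_prod_type, G]
  have h2 : ∑ x, G (M.acrossPerm x) = ∑ x, G x := Equiv.sum_comp _ _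
  have h3 : ∀ x, G x + G (M.acrossPerm x) = 0 := fun x => by
    have hw := weight_act hN hξ (M.orient x.1) x.2
    have := hg x.1.1 x.1.2 x.2
    change _ + weight ξ ((M.orient x.1).act x.2).1 * weight ξ ((M.orient x.1).act x.2).2
      * g (M.nbr x.1).1 (M.nbr x.1).2 ((M.orient x.1).act x.2) = 0
    rw [hw, ← mul_add, this, mul_zero]
  have h4 : ∑ x, G x + ∑ x, G (M.acrossPerm x) = 0 := by
    rw [← Finset.sum_add_distrib]
    exact Finset.sum_eq_zero fun x _ => h3 x
  rw [h1]
  linarith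

/-! ### Entropy balance of the advective terms -/

/-- The contribution of a face node to the advective entropy balance. -/
def advFaceEntropy (M : PeriodicMesh N ξ Elem) (P : Params) (U : Elem → Node N → State)
    (ν : Elem) (f : Face) (ab : Fin (N + 1) × Fin (N + 1)) : ℝ :=
  ∑ n, M.areaVec ν f ab n *
    (entropyVars P (M.prim U ν f ab) ⬝ᵥ ecFlux P (M.prim U ν f ab) (M.sec U ν f ab) n
      - entropyPot P (M.prim U ν f ab) n
      + powellPot P (M.prim U ν f ab)
        * avg (mag (M.prim U ν f ab) n) (mag (M.sec U ν f ab) n))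

theorem sum_surfQuad_advFaceEntropy [Fintype Elem] (hN : 1 ≤ N) (hξ : IsLGL N ξ)
    (M : PeriodicMesh N ξ Elem) {P : Params} (hγ : 1 < P.γ) (U : Elem → Node N → State)
    (hU : ∀ ν p, Admissible P (U ν p)) :
    ∑ ν, surfQuad ξ (M.advFaceEntropy P U ν) = 0 := by
  refine M.sum_surfQuad_eq_zero hN hξ _ fun ν f ab => ?_
  simp only [advFaceEntropy, M.sec_nbr, M.areaVec_nbr hN hξ]
  change _ + ∑ n, _ * (entropyVars P (M.sec U ν f ab) ⬝ᵥ ecFlux P (M.sec U ν f ab)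
    (M.prim U ν f ab) n - entropyPot P (M.sec U ν f ab) n + powellPot P (M.sec U ν f ab)
      * avg (mag (M.sec U ν f ab) n) (mag (M.prim U ν f ab) n)) = 0
  rw [← Finset.sum_add_distrib]
  refine Finset.sum_eq_zero fun n _ => ?_
  have hpri : Admissible P (M.prim U ν f ab) := hU _ _
  have hsec : Admissible P (M.sec U ν f ab) := hU _ _
  have h := ecFlux_entropy_condition hγ hpri hsec n
  rw [ecFlux_comm P (M.sec U ν f ab), avg_comm (mag (M.sec U ν f ab) n), Pi.neg_apply]
  linear_combination M.areaVec ν f ab n * h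

theorem volQuad_adv (hN : 1 ≤ N) (hξ : IsLGL N ξ) (M : PeriodicMesh N ξ Elem) {P : Params}
    (hγ : 1 < P.γ) (ν : Elem) (U : Node N → State) (hU : ∀ p, Admissible P (U p)) :
    volQuad ξ (fun p => M.splitDiv P ν U p ⬝ᵥ entropyVars P (U p))
      + volQuad ξ (fun p => M.powellVol ν U p ⬝ᵥ entropyVars P (U p))
      = surfQuad ξ (fun f ab => ∑ n, M.areaVec ν f ab n *
        (entropyVars P (U (faceNode f ab)) ⬝ᵥ advFlux P (U (faceNode f ab)) n
          - entropyPot P (U (faceNode f ab)) n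
          + powellPot P (U (faceNode f ab)) * mag (U (faceNode f ab)) n)) := by
  -- In the antisymmetric part of `T`, the Powell term compensates the non-conservative remainder of
  -- the two-point flux up to a difference, which is absorbed into the potential `χ`.
  let T : Fin 3 → Node N → Node N → ℝ := fun d p q => ∑ n, avg (M.Ja ν p d n) (M.Ja ν q d n) *
    (2 * (entropyVars P (U p) ⬝ᵥ ecFlux P (U p) (U q) n) + mag (U q) n * powellPot P (U p))
  let χ : Node N → Vec3 := fun p n =>
    entropyPot P (U p) n - 1 / 2 * (mag (U p) n * powellPot P (U p))
  have hT : ∀ d p q, T d p q - T d q p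
      = 2 * ∑ n, avg (M.Ja ν p d n) (M.Ja ν q d n) * (χ p n - χ q n) := fun d p q => by
    simp only [T, χ]
    rw [← Finset.sum_sub_distrib, Finset.mul_sum]
    refine Finset.sum_congr rfl fun n _ => ?_
    have h := ecFlux_entropy_condition hγ (hU p) (hU q) n
    have ha : avg (mag (U p) n) (mag (U q) n) = 1 / 2 * (mag (U p) n + mag (U q) n) := rfl
    rw [ha] at h
    rw [ecFlux_comm P (U q), avg_comm (M.Ja ν q d n)]
    linear_combination 2 * avg (M.Ja ν p d n) (M.Ja ν q d n) * h
  have hsum := volQuad_fluxDiff hN hξ (M.Ja ν) (fun p n => sum_nodalDeriv_metric (M.X ν) p n) T χ hT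
  rw [← volQuad_add]
  have hvol : (fun p => M.splitDiv P ν U p ⬝ᵥ entropyVars P (U p)
      + M.powellVol ν U p ⬝ᵥ entropyVars P (U p))
      = fun p => ∑ d, ∑ m, derMatrix ξ (p d) m * T d p (Function.update p d m) := by
    funext p
    rw [dotProduct_comm, dotProduct_comm (M.powellVol ν U p), splitDiv, powellVol]
    simp only [dotProduct_sum, dotProduct_smul, smul_eq_mul, entropyVars_dot_powell]
    simp only [← Finset.sum_add_distrib]
    refine Finset.sum_congr rfl fun d _ => Finset.sum_congr rfl fun m _ => ?_
    simp only [dotProduct_dotBlock, T]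
    rw [dotProduct, Finset.mul_sum, Finset.mul_sum, Finset.sum_mul, Finset.mul_sum,
      ← Finset.sum_add_distrib]
    refine Finset.sum_congr rfl fun n _ => ?_
    simp only [avgJa]
    ring
  rw [hvol, hsum]
  refine congrArg _ (funext fun f => funext fun ab => ?_)
  simp only [T, χ, ecFlux_self hγ (hU _), avg_self, areaVec]
  rw [Finset.mul_sum, ← Finset.sum_sub_distrib, Finset.mul_sum]
  exact Finset.sum_congr rfl fun n _ => by ring

/-- The advective part of the scheme, tested with the entropy variables, reduces to the faces. -/
theorem adv_balance (hN : 1 ≤ N) (hξ : IsLGL N ξ) (M : PeriodicMesh N ξ Elem) {P : Params}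
    (hγ : 1 < P.γ) (U : Elem → Node N → State) (hU : ∀ ν p, Admissible P (U ν p)) (ν : Elem) :
    volQuad ξ (fun p => M.splitDiv P ν (U ν) p ⬝ᵥ entropyVars P (U ν p))
      + surfQuad ξ (fun f ab => (entropyVars P (U ν (faceNode f ab)) ⬝ᵥ
        advJump P (normal ξ (M.X ν) f ab) (M.prim U ν f ab) (M.sec U ν f ab))
          * surfElem ξ (M.X ν) f ab)
      + volQuad ξ (fun p => M.powellVol ν (U ν) p ⬝ᵥ entropyVars P (U ν p))
      + surfQuad ξ (fun f ab => (entropyVars P (U ν (faceNode f ab)) ⬝ᵥ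
        powellJump (normal ξ (M.X ν) f ab) (M.prim U ν f ab) (M.sec U ν f ab))
          * surfElem ξ (M.X ν) f ab)
      + volQuad ξ (fun p => M.glmVol ν (U ν) p ⬝ᵥ entropyVars P (U ν p))
      + surfQuad ξ (fun f ab => (entropyVars P (U ν (faceNode f ab)) ⬝ᵥ
        glmJump (normal ξ (M.X ν) f ab) (M.prim U ν f ab) (M.sec U ν f ab))
          * surfElem ξ (M.X ν) f ab)
      = surfQuad ξ (M.advFaceEntropy P U ν) := by
  have hglm : ∀ p, M.glmVol ν (U ν) p ⬝ᵥ entropyVars P (U ν p) = 0 := fun p => by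
    rw [dotProduct_comm, glmVol]
    simp [dotProduct_sum, dotProduct_smul, dotProduct_dotBlock, entropyVars_dot_phiGLM]
  have hglm' : ∀ f ab, entropyVars P (U ν (faceNode f ab)) ⬝ᵥ
        glmJump (normal ξ (M.X ν) f ab) (M.prim U ν f ab) (M.sec U ν f ab) = 0 := fun f ab => by
    simp only [glmJump, prim, dotProduct_sub, dotProduct_smul, dotProduct_dotBlock,
      entropyVars_dot_phiGLM]
    simp
  have h0 : volQuad ξ (fun _ => (0 : ℝ)) = 0 := by simp [volQuad]
  have h0' : surfQuad ξ (fun _ _ => (0 : ℝ)) = 0 := by simp [surfQuad]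
  simp only [hglm, hglm', zero_mul, h0, h0', add_zero]
  have hv := M.volQuad_adv hN hξ hγ ν (U ν) (hU ν)
  have hs : surfQuad ξ (M.advFaceEntropy P U ν)
      = surfQuad ξ (fun f ab => ∑ n, M.areaVec ν f ab n *
        (entropyVars P (U ν (faceNode f ab)) ⬝ᵥ advFlux P (U ν (faceNode f ab)) n
          - entropyPot P (U ν (faceNode f ab)) n
          + powellPot P (U ν (faceNode f ab)) * mag (U ν (faceNode f ab)) n))
      + surfQuad ξ (fun f ab => (entropyVars P (U ν (faceNode f ab)) ⬝ᵥ
        advJump P (normal ξ (M.X ν) f ab) (M.prim U ν f ab) (M.sec U ν f ab))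
          * surfElem ξ (M.X ν) f ab)
      + surfQuad ξ (fun f ab => (entropyVars P (U ν (faceNode f ab)) ⬝ᵥ
        powellJump (normal ξ (M.X ν) f ab) (M.prim U ν f ab) (M.sec U ν f ab))
          * surfElem ξ (M.X ν) f ab) := by
    rw [← surfQuad_add, ← surfQuad_add]
    refine congrArg _ (funext fun f => funext fun ab => ?_)
    simp only [advJump, powellJump, dotProduct_sub, dotProduct_smul, dotProduct_dotBlock, sub_mul,
      smul_eq_mul, prim, entropyVars_dot_powell, dotProduct_normal_mul_surfElem]
    rw [dotProduct_comm (mag _), dotProduct_comm (fun c => avg _ _)]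
    simp only [dotProduct, mul_right_comm _ (powellPot _ _) (surfElem _ _ _ _),
      dotProduct_normal_mul_surfElem]
    simp only [Finset.sum_mul, ← Finset.sum_sub_distrib, ← Finset.sum_add_distrib, advFaceEntropy,
      prim, dotProduct]
    exact Finset.sum_congr rfl fun n _ => by ring
  rw [hs]
  linarith

/-! ### Entropy balance of the viscous terms -/

/-- The contribution of a face node to the viscous entropy balance. -/
def viscFaceEntropy (M : PeriodicMesh N ξ Elem) (P : Params) (U : Elem → Node N → State)
    (F : Elem → Node N → Block) (ν : Elem) (f : Face) (ab : Fin (N + 1) × Fin (N + 1)) : ℝ :=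
  ∑ n, M.areaVec ν f ab n * (1 / 2 *
    (entropyVars P (M.sec U ν f ab) ⬝ᵥ M.prim F ν f ab n
      + entropyVars P (M.prim U ν f ab) ⬝ᵥ M.sec F ν f ab n))

theorem sum_surfQuad_viscFaceEntropy [Fintype Elem] (hN : 1 ≤ N) (hξ : IsLGL N ξ)
    (M : PeriodicMesh N ξ Elem) (P : Params) (U : Elem → Node N → State)
    (F : Elem → Node N → Block) :
    ∑ ν, surfQuad ξ (M.viscFaceEntropy P U F ν) = 0 := by
  refine M.sum_surfQuad_eq_zero hN hξ _ fun ν f ab => ?_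
  simp only [viscFaceEntropy, M.sec_nbr, M.areaVec_nbr hN hξ]
  change _ + ∑ n, _ * (1 / 2 * (entropyVars P (M.prim U ν f ab) ⬝ᵥ M.sec F ν f ab n
      + entropyVars P (M.sec U ν f ab) ⬝ᵥ M.prim F ν f ab n)) = 0
  rw [← Finset.sum_add_distrib]
  exact Finset.sum_eq_zero fun n _ => by rw [Pi.neg_apply]; ring

/-- The viscous part of the scheme, tested with the entropy variables. The gradient equation,
tested with the viscous flux, replaces the divergence by the dissipation. -/
theorem visc_balance (M : PeriodicMesh N ξ Elem) {P : Params} (U : Elem → Node N → State)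
    (Q : Elem → Node N → Block) (ν : Elem)
    (hQ : M.GradientEq P U Q ν (M.viscField P U Q ν)) :
    volQuad ξ (fun p => M.stdDiv ν (M.viscField P U Q ν) p ⬝ᵥ entropyVars P (U ν p))
      + surfQuad ξ (fun f ab => (entropyVars P (U ν (faceNode f ab)) ⬝ᵥ
        viscJump (normal ξ (M.X ν) f ab) (M.prim (M.viscField P U Q) ν f ab)
          (M.sec (M.viscField P U Q) ν f ab)) * surfElem ξ (M.X ν) f ab)
      = surfQuad ξ (M.viscFaceEntropy P U (M.viscField P U Q) ν)
        - volQuad ξ (fun p => M.J ν p * ∑ k, Q ν p k ⬝ᵥ viscFlux P (U ν p) (Q ν p) k) := by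
  set F := M.viscField P U Q with hF
  rw [GradientEq] at hQ
  have hs : surfQuad ξ (M.viscFaceEntropy P U F ν)
      = surfQuad ξ (fun f ab =>
        (br1W (entropyVars P (M.prim U ν f ab)) (entropyVars P (M.sec U ν f ab)) ⬝ᵥ
          dotBlock (normal ξ (M.X ν) f ab) (F ν (faceNode f ab))) * surfElem ξ (M.X ν) f ab)
      + surfQuad ξ (fun f ab => (entropyVars P (U ν (faceNode f ab)) ⬝ᵥ
        viscJump (normal ξ (M.X ν) f ab) (M.prim F ν f ab) (M.sec F ν f ab))
          * surfElem ξ (M.X ν) f ab) := by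
    rw [← surfQuad_add]
    refine congrArg _ (funext fun f => funext fun ab => ?_)
    simp only [viscJump, dotProduct_sub, dotProduct_dotBlock, sub_mul,
      dotProduct_normal_mul_surfElem]
    rw [← Finset.sum_sub_distrib, ← Finset.sum_add_distrib, viscFaceEntropy]
    refine Finset.sum_congr rfl fun n _ => ?_
    have h1 : ∀ a b : State, (fun c => avg (a c) (b c)) = (1 / 2 : ℝ) • (a + b) := fun a b => by
      funext c; simp [avg]
    have h2 : ∀ a b : State, br1W a b = (1 / 2 : ℝ) • (a + b) := h1
    simp only [h1, h2, prim, smul_dotProduct, dotProduct_smul, add_dotProduct, dotProduct_add,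
      smul_eq_mul]
    ring
  simp only [dotProduct_comm (M.stdDiv ν (F ν) _)]
  rw [hs]
  have hd : volQuad ξ (fun p => M.J ν p * ∑ k, Q ν p k ⬝ᵥ viscFlux P (U ν p) (Q ν p) k)
      = volQuad ξ (fun p => M.J ν p * ∑ k, Q ν p k ⬝ᵥ F ν p k) := rfl
  rw [hd]
  linarith

/-! ### Entropy stability -/

/-- The rate of change of the total entropy of a solution. -/
def entropyRate [Fintype Elem] (M : PeriodicMesh N ξ Elem) (P : Params)
    (U Ut : Elem → Node N → State) : ℝ :=
  ∑ ν, volQuad ξ (fun p => M.J ν p * (Ut ν p ⬝ᵥ entropyVars P (U ν p)))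

theorem entropyRate_nonpos [Fintype Elem] (hN : 1 ≤ N) (hξ : IsLGL N ξ)
    (M : PeriodicMesh N ξ Elem) {P : Params} (hγ : 1 < P.γ) (hμNS : 0 ≤ P.μNS) (hμR : 0 ≤ P.μR)
    (hκ : 0 ≤ P.κ) (hR : 0 < P.R) (hα : 0 ≤ P.α) (U Ut : Elem → Node N → State)
    (Q : Elem → Node N → Block) (hU : ∀ ν p, Admissible P (U ν p))
    (hsol : ∀ ν, M.SolutionEq P U Ut Q ν fun p => entropyVars P (U ν p))
    (hgrad : ∀ ν, M.GradientEq P U Q ν (M.viscField P U Q ν)) :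
    M.entropyRate P U Ut ≤ 0 := by
  have hν : ∀ ν, volQuad ξ (fun p => M.J ν p * (Ut ν p ⬝ᵥ entropyVars P (U ν p)))
      = surfQuad ξ (M.viscFaceEntropy P U (M.viscField P U Q) ν)
        - surfQuad ξ (M.advFaceEntropy P U ν)
        - volQuad ξ (fun p => M.J ν p * (∑ k, Q ν p k ⬝ᵥ viscFlux P (U ν p) (Q ν p) k
          - entropyVars P (U ν p) ⬝ᵥ source P (U ν p))) := fun ν => by
    have h1 := hsol ν
    have h2 := M.adv_balance hN hξ hγ U hU ν
    have h3 := M.visc_balance U Q ν (hgrad ν)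
    rw [SolutionEq] at h1
    simp only [mul_sub, volQuad_sub, dotProduct_comm (entropyVars P (U ν _)) (source P _)]
    linarith
  have h0 : ∀ ν, 0 ≤ volQuad ξ (fun p => M.J ν p *
      (∑ k, Q ν p k ⬝ᵥ viscFlux P (U ν p) (Q ν p) k
        - entropyVars P (U ν p) ⬝ᵥ source P (U ν p))) := fun ν =>
    volQuad_nonneg hN hξ fun p => mul_nonneg (M.jac_pos ν p).le (sub_nonneg.mpr
      ((entropyVars_dot_source_nonpos hα (hU ν p)).trans
        (sum_dot_viscFlux_nonneg hμNS hμR hκ hR (hU ν p) _)))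
  rw [entropyRate, Finset.sum_congr rfl fun ν _ => hν ν, Finset.sum_sub_distrib,
    Finset.sum_sub_distrib, M.sum_surfQuad_viscFaceEntropy hN hξ,
    M.sum_surfQuad_advFaceEntropy hN hξ hγ U hU]
  have := Finset.sum_nonneg fun ν (_ : ν ∈ Finset.univ) => h0 ν
  linarith

theorem hasDerivWithinAt_totalEntropy [Fintype Elem] (M : PeriodicMesh N ξ Elem) {P : Params}
    (hγ : 1 < P.γ) {I : Set ℝ} {t : ℝ} (ht : t ∈ I) {U : ℝ → Elem → Node N → State}
    {Ut : Elem → Node N → State} (hU : ∀ s ∈ I, ∀ ν p, Admissible P (U s ν p))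
    (hd : ∀ ν p c, HasDerivWithinAt (fun s => U s ν p c) (Ut ν p c) I t) :
    HasDerivWithinAt (fun s => M.totalEntropy P (U s)) (M.entropyRate P (U t) Ut) I t := by
  refine HasDerivWithinAt.fun_sum fun ν _ => HasDerivWithinAt.fun_sum fun p _ => ?_
  exact ((hasDerivWithinAt_entropy hγ ht (hd ν p) fun s hs => hU s hs ν p).const_mul _).const_mul _

end PeriodicMesh

end GLMMHD

end

theorem mainTheorem1 {Elem : Type*} [Fintype Elem] (N : ℕ) (hN : 1 ≤ N)
    (ξ : Fin (N + 1) → ℝ) (hξ : GLMMHD.IsLGL N ξ)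
    (P : GLMMHD.Params) (hγ : 1 < P.γ) (hμNS : 0 ≤ P.μNS) (hμR : 0 ≤ P.μR) (hκ : 0 ≤ P.κ)
    (hR : 0 < P.R) (hα : 0 ≤ P.α)
    (M : GLMMHD.PeriodicMesh N ξ Elem)
    (I : Set ℝ) (hI : I.OrdConnected)
    (U : ℝ → Elem → GLMMHD.Node N → GLMMHD.State)
    (hρ : ∀ t ∈ I, ∀ ν p, 0 < GLMMHD.dens (U t ν p))
    (hp : ∀ t ∈ I, ∀ ν p, 0 < GLMMHD.pressure P (U t ν p))
    (hU : M.IsSolution P I U) :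
    DifferentiableOn ℝ (fun t => M.totalEntropy P (U t)) I ∧
      (∀ t ∈ I, derivWithin (fun t => M.totalEntropy P (U t)) I t ≤ 0) ∧
      AntitoneOn (fun t => M.totalEntropy P (U t)) I := by
  obtain ⟨Ut, Q, hsol⟩ := hU
  have hadm : ∀ t ∈ I, ∀ ν p, GLMMHD.Admissible P (U t ν p) :=
    fun t ht ν p => ⟨hρ t ht ν p, hp t ht ν p⟩
  have hderiv : ∀ t ∈ I, HasDerivWithinAt (fun s => M.totalEntropy P (U s))
      (M.entropyRate P (U t) (Ut t)) I t := fun t ht =>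
    M.hasDerivWithinAt_totalEntropy hγ ht hadm fun ν => (hsol t ht ν).1
  have hrate : ∀ t ∈ I, M.entropyRate P (U t) (Ut t) ≤ 0 := fun t ht =>
    M.entropyRate_nonpos hN hξ hγ hμNS hμR hκ hR hα (U t) (Ut t) (Q t) (hadm t ht)
      (fun ν => (hsol t ht ν).2.1 _) fun ν => (hsol t ht ν).2.2 _
  refine ⟨fun t ht => (hderiv t ht).differentiableWithinAt, fun t ht => ?_, ?_⟩
  · by_cases hu : UniqueDiffWithinAt ℝ I t
    · rw [(hderiv t ht).derivWithin hu]
      exact hrate t ht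
    -- An isolated time, where the derivative within `I` is zero by convention.
    · rw [derivWithin_zero_of_not_uniqueDiffWithinAt hu]
  · exact antitoneOn_of_hasDerivWithinAt_nonpos hI.convex
      (fun t ht => (hderiv t ht).continuousWithinAt)
      (fun t ht => (hderiv t (interior_subset ht)).mono interior_subset)
      fun t ht => hrate t (interior_subset ht)
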